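/- Let $T$ be a relation with $n$ tuples $t_1,\dots,t_n$ and $d\ge 1$ real attributes. A tuple $t$ dominates $t'$ ($t\prec t'$) if $t$ is at most $t'$ on every attribute and strictly smaller on at least one; $t\preceq t'$ means $t\prec t'$ or $t=t'$. The skyline $Sky(A)$ of a set $A$ of tuples consists of the tuples of $A$ that no tuple of $A$ dominates, and $\mathcal{DN}(Q)$ is the number of tuples $t'$ of $T$ with $t\preceq t'$ for some $t\in Q$. The baseline algorithm draws a sample $S$ of $m$ tuples of $T$ ($1\le m\le n$) uniformly at random without replacement, independently of the values of the tuples, and returns $Sky(S)$. Its error is $$\varepsilon=\left|\frac{\mathcal{DN}(Sky(T))-\mathcal{DN}(Sky(S))}{\mathcal{DN}(Sky(T))}\right| .$$ Let $\overline{\varepsilon}$ and $\sigma^2$ be the expectation and the variance of $\varepsilon$ (over both $T$ and $S$). Assume that the tuples of $T$ are i.i.d. random vectors in $\mathbb{R}^d$ with some distribution $\nu$, and that $T$ satisfies component independence: the $d$ attributes of each tuple are independent, and almost surely any two tuples of $T$ differ on every attribute. Let $\mu_{m,d}$ be the expected skyline size of a set of $m$ i.i.d. random tuples with distribution $\nu$.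 Then, for every fixed $d\geq 1$: 1. $\sigma^2=O\!\left(\frac{\mu_{m,d}}{m^2}\right)$ and $\sigma=O\!\left(\frac{\sqrt{\mu_{m,d}}}{m}\right)$; that is, there is a constant $C>0$ depending only on $d$ such that for all $1\le m\le n$ and all such $T$, $\sigma^2\le C\mu_{m,d}/m^2$ and $\sigma\le C\sqrt{\mu_{m,d}}/m$. 2. If $d\ge 2$, then $\frac{\sqrt{\mu_{m,d}}}{m}=o(\overline{\varepsilon})$, and hence $\sigma=o(\overline{\varepsilon})$, as $m\to\infty$ with $m\le cn$ for a fixed $c<1$ (in particular if $m=o(n)$); that is, for all $c\in(0,1)$ and $\delta>0$ there is an $M$ depending only on $d,c,\delta$ such that for all $m\ge \max(M,1)$, all $n$ with $m\le cn$ and all such $T$, $\sqrt{\mu_{m,d}}/m\le\delta\,\overline{\varepsilon}$ and $\sigma\le\delta\,\overline{\varepsilon}$. -/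

import Mathlib

open MeasureTheory ProbabilityTheory

namespace SkylineSampling

/-- Dominance between tuples: `t ≺ t'` if `t` is at most `t'` on every attribute and strictly
smaller on some attribute. -/
def Dominates {d : ℕ} (t t' : Fin d → ℝ) : Prop :=
  (∀ a, t a ≤ t' a) ∧ ∃ a, t a < t' a

/-- Weak dominance `t ⪯ t'`: `t ≺ t'` or `t = t'`. -/
def WeaklyDominates {d : ℕ} (t t' : Fin d → ℝ) : Prop :=
  Dominates t t' ∨ t = t'

open Classical in
/-- The skyline of the sub-relation consisting of the tuples `x i`, `i ∈ A`, of a relation `x` with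
`n` tuples and `d` attributes: the tuples that are dominated by no tuple of the sub-relation. Tuples
are represented by their indices. -/
noncomputable def skyline {n d : ℕ} (x : Fin n → Fin d → ℝ) (A : Finset (Fin n)) :
    Finset (Fin n) :=
  {i ∈ A | ∀ j ∈ A, ¬ Dominates (x j) (x i)}

open Classical in
/-- `DN(Q)`: the number of tuples of the whole relation `x` that are weakly dominated by a tuple
of `Q`. -/
noncomputable def dominatedNumber {n d : ℕ} (x : Fin n → Fin d → ℝ) (Q : Finset (Fin n)) : ℕ :=
  Finset.card {i : Fin n | ∃ j ∈ Q, WeaklyDominates (x j) (x i)}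

/-- The error of an approximate skyline `Q` of the relation `x`. -/
noncomputable def approxError {n d : ℕ} (x : Fin n → Fin d → ℝ) (Q : Finset (Fin n)) : ℝ :=
  |((dominatedNumber x (skyline x Finset.univ) : ℝ) - (dominatedNumber x Q : ℝ)) /
    (dominatedNumber x (skyline x Finset.univ) : ℝ)|

/-- The error of the baseline algorithm on the relation `x` when it draws the sample `A`: the
algorithm returns the skyline of the sample. -/
noncomputable def baselineError {n d : ℕ} (x : Fin n → Fin d → ℝ) (A : Finset (Fin n)) : ℝ :=
  approxError x (skyline x A)

/-- The expected skyline size of a set of `m` i.i.d. random tuples with distribution `ν`. -/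
noncomputable def expectedSkylineSize {d : ℕ} (ν : Measure (Fin d → ℝ)) (m : ℕ) : ℝ :=
  ∫ x : Fin m → Fin d → ℝ, ((skyline x Finset.univ).card : ℝ) ∂(Measure.pi fun _ => ν)

/-- The random relation `T` consists of `n` i.i.d. tuples with distribution `ν`. -/
structure IsIIDRelation {Ω : Type*} [MeasurableSpace Ω] {n d : ℕ} (P : Measure Ω)
    (T : Ω → Fin n → Fin d → ℝ) (ν : Measure (Fin d → ℝ)) : Prop where
  measurable : Measurable T
  indep : iIndepFun (fun i ω => T ω i) P
  law : ∀ i, P.map (fun ω => T ω i) = ν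

/-- Component independence: the attributes of a tuple are independent, and (almost surely) any two
tuples have different values on each attribute. -/
structure ComponentIndependence {Ω : Type*} [MeasurableSpace Ω] {n d : ℕ} (P : Measure Ω)
    (T : Ω → Fin n → Fin d → ℝ) : Prop where
  attribute_indep : ∀ i, iIndepFun (fun a ω => T ω i a) P
  distinct_values : ∀ i j, i ≠ j → ∀ a, ∀ᵐ ω ∂P, T ω i a ≠ T ω j a

/-- `S` is a sample of `m` of the `n` tuples drawn without replacement: uniformly distributed on
the `m`-element subsets of the index set, independently of the relation `T`. -/
structure IsSampleWithoutReplacement {Ω : Type*} [MeasurableSpace Ω] {n d : ℕ} (P : Measure Ω)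
    (T : Ω → Fin n → Fin d → ℝ) (m : ℕ) (S : Ω → Finset (Fin n)) : Prop where
  measurable : Measurable S
  uniform : P.map S = uniformOn {A : Finset (Fin n) | A.card = m}
  indep : IndepFun T S P

/-- The expected error of the baseline algorithm. -/
noncomputable def expectedError {Ω : Type*} [MeasurableSpace Ω] {n d : ℕ} (P : Measure Ω)
    (T : Ω → Fin n → Fin d → ℝ) (S : Ω → Finset (Fin n)) : ℝ :=
  ∫ ω, baselineError (T ω) (S ω) ∂P

/-- The variance `σ²` of the error of the baseline algorithm. -/
noncomputable def errorVariance {Ω : Type*} [MeasurableSpace Ω] {n d : ℕ} (P : Measure Ω)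
    (T : Ω → Fin n → Fin d → ℝ) (S : Ω → Finset (Fin n)) : ℝ :=
  variance (fun ω => baselineError (T ω) (S ω)) P

end SkylineSampling

/-!
Every tuple of a finite relation lies above a skyline tuple, so the error is the fraction of the
tuples outside the sample that no sampled tuple weakly dominates. As the sample is independent of
the relation, its moments may be computed for a fixed sample (`expectedError_eq`,
`expectedError_sq_eq`). With `F u = ν (Iic u)` the mean error is `(n - m) / n` times
`E (1 - F U) ^ m`, while the expected skyline size is `m * E (1 - F U) ^ (m - 1)`.

**Variance.** The variance of the error is at most `E (1 - F U) ^ m / n` plus the variance of the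
measure of the region left uncovered by the sample. The latter is `E (b ^ m - a ^ m)`, where
`b = 1 - F U - F V + F (U ⊓ V)` and `a = (1 - F U) (1 - F V)` for independent `U` and `V`. Since
`0 ≤ b - a ≤ F (U ⊓ V)`, it is at most `m * E (F (U ⊓ V) * b ^ (m - 1))`
(`pairUncoveredProb_sub_sq_le`). Conditioning on the tuple counted by the factor `F (U ⊓ V)`
decouples `U` and `V`, so that up to a constant the last mean is at most the mean of the square of
`G x = E (exp (-m * F U / 2); x ≤ U)`.

**Unit cube.** Applying to each attribute its distribution function turns `ν` into the uniform
distribution on the unit cube and `F` into `Π y = ∏ a, y a`. Replacing the exponential by the powers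
`-5 / 4` and `-2` of `m * Π` makes the integrals products and gives
`G x ^ 2 ≤ C / m ^ 2 * w (m * Π x)` with `w s = min (s ^ (-1 / 2)) (s ^ (-2))`
(`upperMass_sq_le`). Integrating out one coordinate at a time shows that the mean of `w (m * Π)` is
at most a constant times the volume `V` of the region `Π ≤ 1 / m` (`lintegral_upperMass_sq_le`). On this
region `(1 - Π) ^ (m - 1)` is bounded below, so `V` is at most a constant times the expected skyline
size divided by `m`, which is the bound for the variance.

**Comparison with the mean.** From `m * x * (1 - x) ^ (m - 1) ≤ 1` one gets
`E (1 - F U) ^ (m - 1) ≤ E (1 - F U) ^ m + 1 / m`, and for `d ≥ 2` the quantity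
`m * E (1 - F U) ^ m ≥ exp (-2) * m * V ≥ exp (-2) * log m` tends to infinity. Hence the square root
of the expected skyline size is negligible against `m` times the mean error.
-/

namespace SkylineSampling

/-! ### Skylines and the error of a sample -/

lemma dominates_iff_lt {d : ℕ} {t t' : Fin d → ℝ} : Dominates t t' ↔ t < t' := by
  rw [Pi.lt_def]
  rfl

lemma weaklyDominates_iff_le {d : ℕ} {t t' : Fin d → ℝ} : WeaklyDominates t t' ↔ t ≤ t' := by
  rw [WeaklyDominates, dominates_iff_lt, le_iff_lt_or_eq]

/-- Passing to the skyline does not change the set of weakly dominated tuples, since every tuple of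
a finite relation lies above a minimal one. -/
lemma exists_mem_skyline_le_iff {n d : ℕ} (x : Fin n → Fin d → ℝ) (A : Finset (Fin n))
    (t : Fin d → ℝ) : (∃ j ∈ skyline x A, x j ≤ t) ↔ ∃ j ∈ A, x j ≤ t := by
  classical
  constructor
  · rintro ⟨j, hj, hjt⟩
    exact ⟨j, (Finset.mem_filter.1 hj).1, hjt⟩
  · rintro ⟨j, hj, hjt⟩
    obtain ⟨y, hyle, hy⟩ := (A.image x).exists_le_minimal (Finset.mem_image_of_mem x hj)
    obtain ⟨k, hk, rfl⟩ := Finset.mem_image.1 hy.prop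
    refine ⟨k, Finset.mem_filter.2 ⟨hk, fun l hl hlk => ?_⟩, hyle.trans hjt⟩
    exact hy.not_lt (Finset.mem_image_of_mem x hl) (dominates_iff_lt.1 hlk)

open Classical in
lemma dominatedNumber_skyline {n d : ℕ} (x : Fin n → Fin d → ℝ) (A : Finset (Fin n)) :
    dominatedNumber x (skyline x A) = Finset.card {i : Fin n | ∃ j ∈ A, x j ≤ x i} := by
  unfold dominatedNumber
  congr 1
  ext i
  simp only [Finset.mem_filter, Finset.mem_univ, true_and, weaklyDominates_iff_le]
  exact exists_mem_skyline_le_iff x A (x i)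

/-- The event that no tuple of the sub-relation `A` lies below the tuple `i`. -/
def uncovered {n d : ℕ} (A : Finset (Fin n)) (i : Fin n) : Set (Fin n → Fin d → ℝ) :=
  {x | ∀ j ∈ A, ¬ x j ≤ x i}

/-- The error of the baseline algorithm is the fraction of the tuples outside the sample that no
sampled tuple weakly dominates. -/
lemma baselineError_eq_sum {n d : ℕ} (x : Fin n → Fin d → ℝ) (A : Finset (Fin n)) :
    baselineError x A = (∑ i ∈ Aᶜ, (uncovered A i).indicator 1 x) / n := by
  classical
  have huniv : dominatedNumber x (skyline x Finset.univ) = n := by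
    rw [dominatedNumber_skyline, Finset.filter_true_of_mem, Finset.card_univ, Fintype.card_fin]
    exact fun i _ => ⟨i, Finset.mem_univ i, le_rfl⟩
  have hsum : (∑ i ∈ Aᶜ, (uncovered A i).indicator 1 x : ℝ)
      = n - dominatedNumber x (skyline x A) := by
    have hcompl : (∑ i ∈ Aᶜ, (uncovered A i).indicator 1 x : ℝ)
        = ∑ i, (uncovered A i).indicator 1 x := by
      rw [← Finset.sum_add_sum_compl A, right_eq_add]
      refine Finset.sum_eq_zero fun i hi => Set.indicator_of_notMem ?_ _
      exact fun h => h i hi le_rfl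
    have hcard := Finset.card_filter_add_card_filter_not (s := (Finset.univ : Finset (Fin n)))
      (fun i => ∃ j ∈ A, x j ≤ x i)
    rw [Finset.card_univ, Fintype.card_fin] at hcard
    have hcard' : ((Finset.card {i : Fin n | ∃ j ∈ A, x j ≤ x i} : ℕ) : ℝ)
        + (Finset.card {i : Fin n | ¬ ∃ j ∈ A, x j ≤ x i} : ℕ) = n := by exact_mod_cast hcard
    rw [hcompl, dominatedNumber_skyline, ← hcard', add_sub_cancel_left, Finset.card_filter]
    push_cast
    refine Finset.sum_congr rfl fun i _ => ?_
    simp [Set.indicator_apply, uncovered]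
  rw [baselineError, approxError, huniv, ← hsum, abs_of_nonneg]
  exact div_nonneg (Finset.sum_nonneg fun i _ => Set.indicator_nonneg (fun _ _ => zero_le_one) _)
    n.cast_nonneg

lemma baselineError_nonneg {n d : ℕ} (x : Fin n → Fin d → ℝ) (A : Finset (Fin n)) :
    0 ≤ baselineError x A := abs_nonneg _

lemma baselineError_le_one {n d : ℕ} (x : Fin n → Fin d → ℝ) (A : Finset (Fin n)) :
    baselineError x A ≤ 1 := by
  rw [baselineError_eq_sum]
  refine div_le_one_of_le₀ ?_ n.cast_nonneg
  calc (∑ i ∈ Aᶜ, (uncovered A i).indicator 1 x : ℝ)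
      ≤ ∑ _i ∈ Aᶜ, (1 : ℝ) :=
        Finset.sum_le_sum fun i _ => Set.indicator_le_self' (fun _ _ => zero_le_one) x
    _ ≤ n := by
        rw [Finset.sum_const, nsmul_one]
        exact_mod_cast Aᶜ.card_le_univ.trans_eq (Fintype.card_fin n)

lemma measurableSet_uncovered {n d : ℕ} (A : Finset (Fin n)) (i : Fin n) :
    MeasurableSet (uncovered A i : Set (Fin n → Fin d → ℝ)) := by
  have : (uncovered A i : Set (Fin n → Fin d → ℝ)) = ⋂ j ∈ A, {x | x j ≤ x i}ᶜ := by
    ext x; simp [uncovered]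
  rw [this]
  exact Finset.measurableSet_biInter A fun j _ =>
    (measurableSet_le (measurable_pi_apply j) (measurable_pi_apply i)).compl

lemma measurable_baselineError {n d : ℕ} (A : Finset (Fin n)) :
    Measurable fun x : Fin n → Fin d → ℝ => baselineError x A := by
  simp_rw [baselineError_eq_sum]
  refine (Finset.measurable_sum _ fun i _ => ?_).div_const _
  exact measurable_one.indicator (measurableSet_uncovered A i)

/-! ### Avoidance probabilities of i.i.d. points -/

section Avoidance

variable {ι E G : Type*} [Fintype ι] [MeasurableSpace E] [MeasurableSpace G]

/-- If `Y` is independent of the coordinates in `A`, then conditionally on `Y` the coordinates in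
`A` are independent, so the probability that they all satisfy a constraint depending on `Y` is the
mean of a power. -/
lemma measureReal_forall_mem (ν : Measure E) [IsProbabilityMeasure ν] (A : Finset ι)
    {Y : (ι → E) → G} (hY : Measurable Y)
    (hind : IndepFun Y (fun (x : ι → E) (j : A) => x j) (Measure.pi fun _ => ν))
    {R : Set (G × E)} (hR : MeasurableSet R) :
    (Measure.pi fun _ : ι => ν).real {x | ∀ j ∈ A, (Y x, x j) ∈ R} =
      ∫ y, ν.real (Prod.mk y ⁻¹' R) ^ A.card ∂((Measure.pi fun _ => ν).map Y) := by
  classical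
  have hZ : Measurable fun (x : ι → E) (j : A) => x j := by fun_prop
  have hprobY : IsProbabilityMeasure ((Measure.pi fun _ : ι => ν).map Y) :=
    Measure.isProbabilityMeasure_map hY.aemeasurable
  have hmapZ : (Measure.pi fun _ : ι => ν).map (fun (x : ι → E) (j : A) => x j)
      = Measure.pi fun _ : A => ν := by
    have h := iIndepFun.precomp (g := ((↑) : A → ι)) Subtype.val_injective
      (iIndepFun_pi (μ := fun _ : ι => ν) (X := fun _ => id) fun _ => aemeasurable_id)
    refine ((iIndepFun_iff_map_fun_eq_pi_map fun j => ?_).1 h).trans ?_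
    · exact (measurable_pi_apply (j : ι)).aemeasurable
    · congr 1
      ext1 j
      exact (measurePreserving_eval (fun _ : ι => ν) (j : ι)).map_eq
  have hlaw := (indepFun_iff_map_prod_eq_prod_map_map hY.aemeasurable hZ.aemeasurable).1 hind
  rw [hmapZ] at hlaw
  have hmeas : MeasurableSet {p : G × (A → E) | ∀ j, (p.1, p.2 j) ∈ R} := by
    rw [Set.ofPred_forall]
    exact MeasurableSet.iInter fun j =>
      hR.preimage (measurable_fst.prodMk ((measurable_pi_apply j).comp measurable_snd))
  have hset : {x : ι → E | ∀ j ∈ A, (Y x, x j) ∈ R}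
      = (fun x => (Y x, fun j : A => x j)) ⁻¹' {p : G × (A → E) | ∀ j, (p.1, p.2 j) ∈ R} := by
    ext x; simp
  have hslice : ∀ y : G, (Measure.pi fun _ : A => ν)
      (Prod.mk y ⁻¹' {p : G × (A → E) | ∀ j, (p.1, p.2 j) ∈ R})
        = ENNReal.ofReal (ν.real (Prod.mk y ⁻¹' R) ^ A.card) := by
    intro y
    have : (Prod.mk y ⁻¹' {p : G × (A → E) | ∀ j, (p.1, p.2 j) ∈ R})
        = Set.univ.pi fun _ : A => Prod.mk y ⁻¹' R := by
      ext z; simp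
    rw [this, Measure.pi_pi, Finset.prod_const, Finset.card_univ, Fintype.card_coe,
      ENNReal.ofReal_pow measureReal_nonneg, ofReal_measureReal]
  rw [hset, measureReal_def, ← Measure.map_apply (hY.prodMk hZ) hmeas, hlaw,
    Measure.prod_apply hmeas, integral_eq_lintegral_of_nonneg_ae]
  · simp_rw [hslice]
  · exact Filter.Eventually.of_forall fun y => pow_nonneg measureReal_nonneg _
  · exact ((measurable_measure_prodMk_left hR).ennreal_toReal.pow_const _).aestronglyMeasurable

lemma measureReal_forall_mem_eval (ν : Measure E) [IsProbabilityMeasure ν] {A : Finset ι} {i : ι}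
    (hi : i ∉ A) {R : Set (E × E)} (hR : MeasurableSet R) :
    (Measure.pi fun _ : ι => ν).real {x | ∀ j ∈ A, (x i, x j) ∈ R} =
      ∫ u, ν.real (Prod.mk u ⁻¹' R) ^ A.card ∂ν := by
  classical
  have hiid := iIndepFun_pi (μ := fun _ : ι => ν) (X := fun _ => id) fun _ => aemeasurable_id
  have h := hiid.indepFun_finset {i} A (by simpa using hi) fun j => measurable_pi_apply j
  have h' := h.comp (measurable_pi_apply (⟨i, Finset.mem_singleton_self i⟩ : ({i} : Finset ι)))
    measurable_id
  refine (measureReal_forall_mem ν A (measurable_pi_apply i) h' hR).trans ?_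
  have hei : (Measure.pi fun _ : ι => ν).map (fun x => x i) = ν :=
    (measurePreserving_eval (fun _ : ι => ν) i).map_eq
  rw [hei]

lemma measureReal_forall_mem_eval_pair (ν : Measure E) [IsProbabilityMeasure ν] {A : Finset ι}
    {i j : ι} (hi : i ∉ A) (hj : j ∉ A) (hij : i ≠ j) {R : Set ((E × E) × E)}
    (hR : MeasurableSet R) :
    (Measure.pi fun _ : ι => ν).real {x | ∀ k ∈ A, ((x i, x j), x k) ∈ R} =
      ∫ p, ν.real (Prod.mk p ⁻¹' R) ^ A.card ∂(ν.prod ν) := by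
  classical
  have hiid := iIndepFun_pi (μ := fun _ : ι => ν) (X := fun _ => id) fun _ => aemeasurable_id
  have h := hiid.indepFun_finset {i, j} A (by simp [hi, hj]) fun k => measurable_pi_apply k
  have hpair : Measurable fun y : ({i, j} : Finset ι) → E =>
      (y ⟨i, by simp⟩, y ⟨j, by simp⟩) := by fun_prop
  have h' := h.comp hpair measurable_id
  have hmi : Measurable fun x : ι → E => x i := measurable_pi_apply i
  have hmj : Measurable fun x : ι → E => x j := measurable_pi_apply j
  refine (measureReal_forall_mem ν A (hmi.prodMk hmj) h' hR).trans ?_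
  have hlaw := (indepFun_iff_map_prod_eq_prod_map_map hmi.aemeasurable hmj.aemeasurable).1
    (hiid.indepFun hij)
  have hei : (Measure.pi fun _ : ι => ν).map (fun x => x i) = ν :=
    (measurePreserving_eval (fun _ : ι => ν) i).map_eq
  have hej : (Measure.pi fun _ : ι => ν).map (fun x => x j) = ν :=
    (measurePreserving_eval (fun _ : ι => ν) j).map_eq
  rw [hlaw, hei, hej]

end Avoidance

/-- The probability that none of `m` i.i.d. tuples weakly dominates a further one. -/
noncomputable def uncoveredProb {d : ℕ} (ν : Measure (Fin d → ℝ)) (m : ℕ) : ℝ :=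
  ∫ u, (1 - ν.real (Set.Iic u)) ^ m ∂ν

/-- The probability that a random tuple weakly dominates neither `u` nor `v`. -/
noncomputable def pairAvoid {d : ℕ} (ν : Measure (Fin d → ℝ)) (u v : Fin d → ℝ) : ℝ :=
  1 - ν.real (Set.Iic u) - ν.real (Set.Iic v) + ν.real (Set.Iic (u ⊓ v))

/-- The probability that none of `m` i.i.d. tuples weakly dominates one of two further ones. -/
noncomputable def pairUncoveredProb {d : ℕ} (ν : Measure (Fin d → ℝ)) (m : ℕ) : ℝ :=
  ∫ p, pairAvoid ν p.1 p.2 ^ m ∂(ν.prod ν)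

section Sample

variable {d : ℕ} (ν : Measure (Fin d → ℝ)) [IsProbabilityMeasure ν]

lemma measureReal_not_le (u : Fin d → ℝ) :
    ν.real {e | ¬ e ≤ u} = 1 - ν.real (Set.Iic u) :=
  probReal_compl_eq_one_sub measurableSet_Iic

lemma measureReal_not_le_and_not_le (u v : Fin d → ℝ) :
    ν.real {e | ¬ e ≤ u ∧ ¬ e ≤ v} = pairAvoid ν u v := by
  have h : {e : Fin d → ℝ | ¬ e ≤ u ∧ ¬ e ≤ v} = (Set.Iic u ∪ Set.Iic v)ᶜ := by
    ext e; simp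
  have h2 := measureReal_union_add_inter (μ := ν) (s := Set.Iic u) (measurableSet_Iic (a := v))
  rw [Set.Iic_inter_Iic] at h2
  rw [h, probReal_compl_eq_one_sub (measurableSet_Iic.union measurableSet_Iic), pairAvoid]
  linarith

lemma measureReal_uncovered {n : ℕ} {A : Finset (Fin n)} {i : Fin n} (hi : i ∉ A) :
    (Measure.pi fun _ => ν).real (uncovered A i) = uncoveredProb ν A.card := by
  have hR : MeasurableSet {p : (Fin d → ℝ) × (Fin d → ℝ) | ¬ p.2 ≤ p.1} :=
    (measurableSet_le measurable_snd measurable_fst).compl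
  refine (measureReal_forall_mem_eval ν hi hR).trans ?_
  simp only [Set.preimage_ofPred_eq, measureReal_not_le, uncoveredProb]

lemma measureReal_uncovered_inter {n : ℕ} {A : Finset (Fin n)} {i j : Fin n} (hi : i ∉ A)
    (hj : j ∉ A) (hij : i ≠ j) :
    (Measure.pi fun _ => ν).real (uncovered A i ∩ uncovered A j)
      = pairUncoveredProb ν A.card := by
  have hR : MeasurableSet {p : ((Fin d → ℝ) × (Fin d → ℝ)) × (Fin d → ℝ) |
      ¬ p.2 ≤ p.1.1 ∧ ¬ p.2 ≤ p.1.2} :=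
    (measurableSet_le measurable_snd (measurable_fst.comp measurable_fst)).compl.inter
      (measurableSet_le measurable_snd (measurable_snd.comp measurable_fst)).compl
  have hset : (uncovered A i ∩ uncovered A j : Set (Fin n → Fin d → ℝ))
      = {x | ∀ k ∈ A, ((x i, x j), x k) ∈ {p : ((Fin d → ℝ) × (Fin d → ℝ)) × (Fin d → ℝ) |
        ¬ p.2 ≤ p.1.1 ∧ ¬ p.2 ≤ p.1.2}} := by
    ext x
    simp only [uncovered, Set.mem_inter_iff, Set.mem_ofPred_eq]
    exact ⟨fun h k hk => ⟨h.1 k hk, h.2 k hk⟩, fun h => ⟨fun k hk => (h k hk).1,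
      fun k hk => (h k hk).2⟩⟩
  rw [hset]
  refine (measureReal_forall_mem_eval_pair ν hi hj hij hR).trans ?_
  simp only [Set.preimage_ofPred_eq, measureReal_not_le_and_not_le, pairUncoveredProb]

/-- The mean error for a fixed sample `A`. -/
lemma integral_baselineError {n : ℕ} (A : Finset (Fin n)) :
    ∫ x, baselineError x A ∂(Measure.pi fun _ => ν)
      = (n - A.card : ℕ) / n * uncoveredProb ν A.card := by
  simp_rw [baselineError_eq_sum]
  rw [integral_div, integral_finsetSum]
  · have : ∀ i ∈ Aᶜ, ∫ x, (uncovered A i).indicator 1 x ∂(Measure.pi fun _ : Fin n => ν)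
        = uncoveredProb ν A.card := fun i hi => by
      rw [integral_indicator_one (measurableSet_uncovered A i),
        measureReal_uncovered ν (Finset.mem_compl.1 hi)]
    rw [Finset.sum_congr rfl this, Finset.sum_const, Finset.card_compl, Fintype.card_fin,
      nsmul_eq_mul]
    ring
  · exact fun i _ => (integrable_const (1 : ℝ)).indicator (measurableSet_uncovered A i)

/-- The second moment of the error for a fixed sample `A`: a double sum over the tuples outside
the sample, split into its diagonal and the rest. -/
lemma integral_baselineError_sq {n : ℕ} (A : Finset (Fin n)) :
    ∫ x, baselineError x A ^ 2 ∂(Measure.pi fun _ => ν)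
      = ((n - A.card : ℕ) * uncoveredProb ν A.card
        + (n - A.card : ℕ) * ((n - A.card : ℕ) - 1) * pairUncoveredProb ν A.card) / n ^ 2 := by
  classical
  have hexp : ∀ x : Fin n → Fin d → ℝ, baselineError x A ^ 2
      = (∑ i ∈ Aᶜ, ∑ j ∈ Aᶜ, (uncovered A i ∩ uncovered A j).indicator 1 x) / n ^ 2 := by
    intro x
    rw [baselineError_eq_sum, div_pow, sq (∑ i ∈ Aᶜ, _), Finset.sum_mul_sum]
    simp_rw [Set.inter_indicator_one, Pi.mul_apply]
  have hint : ∀ i j, Integrable (fun x : Fin n → Fin d → ℝ =>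
      (uncovered A i ∩ uncovered A j).indicator (1 : (Fin n → Fin d → ℝ) → ℝ) x)
      (Measure.pi fun _ => ν) :=
    fun i j => (integrable_const (1 : ℝ)).indicator
      ((measurableSet_uncovered A i).inter (measurableSet_uncovered A j))
  simp_rw [hexp]
  rw [integral_div, integral_finsetSum _ fun i _ => integrable_finsetSum _ fun j _ => hint i j]
  have hrow : ∀ i ∈ Aᶜ, ∫ x, ∑ j ∈ Aᶜ, (uncovered A i ∩ uncovered A j).indicator 1 x
      ∂(Measure.pi fun _ : Fin n => ν)
      = uncoveredProb ν A.card + ((n - A.card : ℕ) - 1) * pairUncoveredProb ν A.card := by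
    intro i hi
    have hiA := Finset.mem_compl.1 hi
    rw [integral_finsetSum _ fun j _ => hint i j]
    have hterm : ∀ j, ∫ x, (uncovered A i ∩ uncovered A j).indicator 1 x
        ∂(Measure.pi fun _ : Fin n => ν)
        = (Measure.pi fun _ => ν).real (uncovered A i ∩ uncovered A j) := fun j =>
      integral_indicator_one ((measurableSet_uncovered A i).inter (measurableSet_uncovered A j))
    simp_rw [hterm]
    rw [← Finset.add_sum_erase _ _ hi, Set.inter_self, measureReal_uncovered ν hiA]
    congr 1
    rw [Finset.sum_congr rfl fun j hj => measureReal_uncovered_inter ν hiA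
      (Finset.mem_compl.1 (Finset.mem_of_mem_erase hj)) (Finset.ne_of_mem_erase hj).symm,
      Finset.sum_const, Finset.card_erase_of_mem hi, nsmul_eq_mul,
      Nat.cast_sub (Finset.card_pos.2 ⟨i, hi⟩), Finset.card_compl, Fintype.card_fin, Nat.cast_one]
  rw [Finset.sum_congr rfl hrow, Finset.sum_const, Finset.card_compl, Fintype.card_fin,
    nsmul_eq_mul]
  ring

/-- The expected skyline size in terms of avoidance probabilities; without atoms, strict and weak
dominance have the same probability. -/
lemma expectedSkylineSize_eq [NullSingletonClass ν] (m : ℕ) :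
    expectedSkylineSize ν m = m * uncoveredProb ν (m - 1) := by
  classical
  have hR : MeasurableSet {p : (Fin d → ℝ) × (Fin d → ℝ) | ¬ Dominates p.2 p.1} := by
    simp_rw [dominates_iff_lt, lt_iff_le_not_ge]
    exact ((measurableSet_le measurable_snd measurable_fst).inter
      (measurableSet_le measurable_fst measurable_snd).compl).compl
  have hmem : ∀ i : Fin m, {x : Fin m → Fin d → ℝ | i ∈ skyline x Finset.univ} =
      {x | ∀ j ∈ Finset.univ.erase i, (x i, x j) ∈ {p : (Fin d → ℝ) × (Fin d → ℝ) |
        ¬ Dominates p.2 p.1}} := by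
    intro i
    ext x
    simp only [skyline, Finset.mem_filter, Finset.mem_univ, true_and, forall_const,
      Finset.mem_erase, and_true, Set.mem_ofPred_eq]
    refine ⟨fun h j _ => h j, fun h j => ?_⟩
    by_cases hji : j = i
    · subst hji
      rw [dominates_iff_lt]
      exact lt_irrefl _
    · exact h j hji
  have hmeas : ∀ i : Fin m,
      MeasurableSet {x : Fin m → Fin d → ℝ | i ∈ skyline x Finset.univ} := by
    intro i
    simp_rw [hmem, Set.ofPred_forall]
    exact Finset.measurableSet_biInter _ fun j _ =>
      hR.preimage ((measurable_pi_apply i).prodMk (measurable_pi_apply j))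
  have hslice : ∀ u : Fin d → ℝ, ν.real (Prod.mk u ⁻¹' {p : (Fin d → ℝ) × (Fin d → ℝ) |
      ¬ Dominates p.2 p.1}) = 1 - ν.real (Set.Iic u) := by
    intro u
    have : Prod.mk u ⁻¹' {p : (Fin d → ℝ) × (Fin d → ℝ) | ¬ Dominates p.2 p.1}
        = (Set.Iio u)ᶜ := by
      ext e; simp [dominates_iff_lt]
    have hIio : MeasurableSet (Set.Iio u) := by
      have h := hR.compl.preimage (measurable_const (a := u) |>.prodMk measurable_id)
      convert h using 1
      ext e; simp [dominates_iff_lt]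
    rw [this, probReal_compl_eq_one_sub hIio, measureReal_congr Iio_ae_eq_Iic]
  have hcard : ∀ x : Fin m → Fin d → ℝ, ((skyline x Finset.univ).card : ℝ)
      = ∑ i, {x : Fin m → Fin d → ℝ | i ∈ skyline x Finset.univ}.indicator 1 x := by
    intro x
    simp [Set.indicator_apply]
  have hterm : ∀ i : Fin m, ∫ x, {x : Fin m → Fin d → ℝ | i ∈ skyline x Finset.univ}.indicator 1 x
        ∂(Measure.pi fun _ => ν) = uncoveredProb ν (m - 1) := by
    intro i
    rw [integral_indicator_one (hmeas i), hmem i,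
      measureReal_forall_mem_eval ν (Finset.notMem_erase i _) hR,
      Finset.card_erase_of_mem (Finset.mem_univ i), Finset.card_univ, Fintype.card_fin]
    simp_rw [hslice, uncoveredProb]
  rw [expectedSkylineSize]
  simp_rw [hcard]
  rw [integral_finsetSum]
  swap
  · exact fun i _ => (integrable_const (1 : ℝ)).indicator (hmeas i)
  rw [Finset.sum_congr rfl fun i _ => hterm i, Finset.sum_const, Finset.card_univ,
    Fintype.card_fin, nsmul_eq_mul]

end Sample

/-! ### The moments of the error of a random sample -/

section Moments

variable {Ω : Type*} [MeasurableSpace Ω] {n d m : ℕ} {P : Measure Ω}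
  {ν : Measure (Fin d → ℝ)} {T : Ω → Fin n → Fin d → ℝ} {S : Ω → Finset (Fin n)}

lemma IsSampleWithoutReplacement.ae_card (hS : IsSampleWithoutReplacement P T m S) :
    ∀ᵐ A ∂(P.map S), A.card = m := by
  rw [hS.uniform]
  exact ae_cond_mem (Set.toFinite _).measurableSet

/-- If every tuple is sampled, then the error vanishes. -/
lemma errorVariance_self (hS : IsSampleWithoutReplacement P T n S) :
    errorVariance P T S = 0 := by
  have hzero : (fun ω => baselineError (T ω) (S ω)) =ᵐ[P] 0 := by
    filter_upwards [ae_of_ae_map hS.measurable.aemeasurable hS.ae_card] with ω hω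
    have : S ω = Finset.univ := Finset.card_eq_iff_eq_univ _ |>.1 (by simpa using hω)
    rw [this, baselineError_eq_sum]
    simp
  rw [errorVariance, variance_congr hzero, variance_zero]

lemma measurable_baselineError_uncurry :
    Measurable fun p : (Fin n → Fin d → ℝ) × Finset (Fin n) => baselineError p.1 p.2 :=
  measurable_from_prod_countable_left fun A => measurable_baselineError A

lemma measurable_baselineError_sample (hT : IsIIDRelation P T ν)
    (hS : IsSampleWithoutReplacement P T m S) :
    Measurable fun ω => baselineError (T ω) (S ω) := by
  have hTS : Measurable fun ω => (T ω, S ω) := hT.measurable.prodMk hS.measurable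
  have h := measurable_baselineError_uncurry.comp hTS
  exact h

variable [IsProbabilityMeasure P]

lemma IsIIDRelation.map_eq_pi (hT : IsIIDRelation P T ν) :
    P.map T = Measure.pi fun _ => ν := by
  have h := (iIndepFun_iff_map_fun_eq_pi_map
    fun i => ((measurable_pi_apply i).comp hT.measurable).aemeasurable).1 hT.indep
  refine h.trans ?_
  congr 1
  ext1 i
  exact hT.law i

/-- As the sample is independent of the relation, the mean of a functional of both is its mean for
a fixed sample, as soon as the latter depends on the size of the sample only. -/
lemma integral_relation_sample [IsProbabilityMeasure ν] (hT : IsIIDRelation P T ν)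
    (hS : IsSampleWithoutReplacement P T m S)
    {g : (Fin n → Fin d → ℝ) → Finset (Fin n) → ℝ} (hg : ∀ A, Measurable fun x => g x A)
    (hg0 : ∀ x A, 0 ≤ g x A) (hg1 : ∀ x A, g x A ≤ 1) {c : ℝ}
    (hc : ∀ A : Finset (Fin n), A.card = m → ∫ x, g x A ∂(Measure.pi fun _ => ν) = c) :
    ∫ ω, g (T ω) (S ω) ∂P = c := by
  have hprob : IsProbabilityMeasure (P.map S) :=
    Measure.isProbabilityMeasure_map hS.measurable.aemeasurable
  have hmeas : Measurable fun p : (Fin n → Fin d → ℝ) × Finset (Fin n) => g p.1 p.2 :=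
    measurable_from_prod_countable_left hg
  have hlaw := (indepFun_iff_map_prod_eq_prod_map_map hT.measurable.aemeasurable
    hS.measurable.aemeasurable).1 hS.indep
  rw [hT.map_eq_pi] at hlaw
  have hint : Integrable (fun p : (Fin n → Fin d → ℝ) × Finset (Fin n) => g p.1 p.2)
      ((Measure.pi fun _ => ν).prod (P.map S)) :=
    Integrable.of_bound hmeas.aestronglyMeasurable 1 (Filter.Eventually.of_forall fun p => by
      rw [Real.norm_of_nonneg (hg0 _ _)]; exact hg1 _ _)
  have hmap := integral_map (μ := P) (hT.measurable.prodMk hS.measurable).aemeasurable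
    (f := fun p : (Fin n → Fin d → ℝ) × Finset (Fin n) => g p.1 p.2)
    hmeas.aestronglyMeasurable
  rw [← hmap, hlaw, integral_prod_symm _ hint,
    integral_congr_ae (hS.ae_card.mono fun A hA => hc A hA)]
  simp

lemma expectedError_eq [IsProbabilityMeasure ν] (hT : IsIIDRelation P T ν)
    (hS : IsSampleWithoutReplacement P T m S) :
    expectedError P T S = (n - m : ℕ) / n * uncoveredProb ν m :=
  integral_relation_sample hT hS measurable_baselineError baselineError_nonneg
    baselineError_le_one fun A hA => by rw [integral_baselineError, hA]

lemma expectedError_sq_eq [IsProbabilityMeasure ν] (hT : IsIIDRelation P T ν)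
    (hS : IsSampleWithoutReplacement P T m S) :
    ∫ ω, baselineError (T ω) (S ω) ^ 2 ∂P
      = ((n - m : ℕ) * uncoveredProb ν m
        + (n - m : ℕ) * ((n - m : ℕ) - 1) * pairUncoveredProb ν m) / n ^ 2 :=
  integral_relation_sample hT hS (g := fun x A => baselineError x A ^ 2)
    (fun A => (measurable_baselineError A).pow_const 2) (fun x A => sq_nonneg _)
    (fun x A => pow_le_one₀ (baselineError_nonneg x A) (baselineError_le_one x A))
    fun A hA => by rw [integral_baselineError_sq, hA]

lemma pairAvoid_nonneg (ν : Measure (Fin d → ℝ)) [IsProbabilityMeasure ν] (u v : Fin d → ℝ) :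
    0 ≤ pairAvoid ν u v := by
  rw [← measureReal_not_le_and_not_le]
  exact measureReal_nonneg

lemma pairAvoid_le_one (ν : Measure (Fin d → ℝ)) [IsProbabilityMeasure ν] (u v : Fin d → ℝ) :
    pairAvoid ν u v ≤ 1 := by
  rw [← measureReal_not_le_and_not_le]
  exact measureReal_le_one

lemma uncoveredProb_nonneg (ν : Measure (Fin d → ℝ)) [IsProbabilityMeasure ν] (m : ℕ) :
    0 ≤ uncoveredProb ν m :=
  integral_nonneg fun _ => pow_nonneg (sub_nonneg.2 measureReal_le_one) m

lemma pairUncoveredProb_nonneg (ν : Measure (Fin d → ℝ)) [IsProbabilityMeasure ν] (m : ℕ) :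
    0 ≤ pairUncoveredProb ν m :=
  integral_nonneg fun p => pow_nonneg (pairAvoid_nonneg ν p.1 p.2) m

/-- The variance splits into the contribution of the tuples outside the sample and the variance of
the measure of the region not covered by the sample. -/
lemma errorVariance_le [IsProbabilityMeasure ν] (hT : IsIIDRelation P T ν)
    (hS : IsSampleWithoutReplacement P T m S) (hn : 0 < n) :
    errorVariance P T S ≤ uncoveredProb ν m / n
      + ((n - m : ℕ) / n) ^ 2 * (pairUncoveredProb ν m - uncoveredProb ν m ^ 2) := by
  have hn' : (0 : ℝ) < n := Nat.cast_pos.2 hn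
  have hk : ((n - m : ℕ) : ℝ) ≤ n := by exact_mod_cast Nat.sub_le n m
  have hLp : MemLp (fun ω => baselineError (T ω) (S ω)) 2 P :=
    MemLp.of_bound (measurable_baselineError_sample hT hS).aestronglyMeasurable 1
      (Filter.Eventually.of_forall fun ω => by
        rw [Real.norm_of_nonneg (baselineError_nonneg _ _)]; exact baselineError_le_one _ _)
  have hE := expectedError_eq hT hS
  rw [expectedError] at hE
  have hE2 := expectedError_sq_eq hT hS
  rw [errorVariance, variance_eq_sub hLp]
  simp only [Pi.pow_apply]
  rw [hE, hE2]
  have h1 := uncoveredProb_nonneg ν m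
  have h2 := pairUncoveredProb_nonneg ν m
  have hk0 : (0 : ℝ) ≤ (n - m : ℕ) := Nat.cast_nonneg _
  generalize ((n - m : ℕ) : ℝ) = k at *
  have : uncoveredProb ν m / n + (k / n) ^ 2 * (pairUncoveredProb ν m - uncoveredProb ν m ^ 2)
      - ((k * uncoveredProb ν m + k * (k - 1) * pairUncoveredProb ν m) / n ^ 2
        - (k / n * uncoveredProb ν m) ^ 2)
      = ((n - k) * uncoveredProb ν m + k * pairUncoveredProb ν m) / n ^ 2 := by
    field_simp
    ring
  have hnn : 0 ≤ ((n - k) * uncoveredProb ν m + k * pairUncoveredProb ν m) / (n : ℝ) ^ 2 :=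
    div_nonneg (add_nonneg (mul_nonneg (sub_nonneg.2 hk) h1) (mul_nonneg hk0 h2)) (by positivity)
  linarith

end Moments

/-! ### The variance of the uncovered region -/

/-- The probability that a random tuple weakly dominates two others while `m` further ones weakly
dominate neither. -/
noncomputable def sharedCover {d : ℕ} (ν : Measure (Fin d → ℝ)) (m : ℕ) : ℝ :=
  ∫ p, ν.real (Set.Iic (p.1 ⊓ p.2)) * pairAvoid ν p.1 p.2 ^ m ∂(ν.prod ν)

lemma pow_sub_pow_le_mul {a b : ℝ} (ha : 0 ≤ a) (hab : a ≤ b) (m : ℕ) :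
    b ^ m - a ^ m ≤ m * ((b - a) * b ^ (m - 1)) := by
  have hb := ha.trans hab
  rw [← geom_sum₂_mul, mul_comm (b - a), ← mul_assoc]
  refine mul_le_mul_of_nonneg_right ?_ (sub_nonneg.2 hab)
  calc ∑ i ∈ Finset.range m, b ^ i * a ^ (m - 1 - i)
      ≤ ∑ _i ∈ Finset.range m, b ^ (m - 1) := Finset.sum_le_sum fun i hi => by
        have : b ^ (m - 1) = b ^ i * b ^ (m - 1 - i) := by
          rw [← pow_add]
          congr 1
          have := Finset.mem_range.1 hi
          omega
        rw [this]
        gcongr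
    _ = m * b ^ (m - 1) := by rw [Finset.sum_const, Finset.card_range, nsmul_eq_mul]

section Measurability

variable {d : ℕ} (ν : Measure (Fin d → ℝ)) [IsProbabilityMeasure ν]

lemma measurable_measureReal_Iic : Measurable fun u : Fin d → ℝ => ν.real (Set.Iic u) :=
  (measurable_measure_prodMk_left
    (measurableSet_le (measurable_snd (α := Fin d → ℝ) (β := Fin d → ℝ)) measurable_fst)
      ).ennreal_toReal

lemma measurable_measureReal_Iic_inf :
    Measurable fun p : (Fin d → ℝ) × (Fin d → ℝ) => ν.real (Set.Iic (p.1 ⊓ p.2)) :=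
  (measurable_measureReal_Iic ν).comp (measurable_pi_lambda _ fun a =>
    ((measurable_pi_apply a).comp measurable_fst).inf ((measurable_pi_apply a).comp measurable_snd))

lemma measurable_pairAvoid :
    Measurable fun p : (Fin d → ℝ) × (Fin d → ℝ) => pairAvoid ν p.1 p.2 :=
  ((((measurable_measureReal_Iic ν).comp measurable_fst).const_sub 1).sub
    ((measurable_measureReal_Iic ν).comp measurable_snd)).add (measurable_measureReal_Iic_inf ν)

end Measurability

/-- The variance of the measure of the uncovered region is the mean of `b ^ m - a ^ m`, where `b`
and `a` are the probabilities that a tuple misses both of two given ones and that two independent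
tuples miss one each. The hypothesis is the positive association of the two lower orthants. -/
lemma pairUncoveredProb_sub_sq_le {d : ℕ} (ν : Measure (Fin d → ℝ)) [IsProbabilityMeasure ν]
    (hassoc : ∀ u v, ν.real (Set.Iic u) * ν.real (Set.Iic v) ≤ ν.real (Set.Iic (u ⊓ v))) (m : ℕ) :
    pairUncoveredProb ν m - uncoveredProb ν m ^ 2 ≤ m * sharedCover ν (m - 1) := by
  have hF0 : ∀ u, 0 ≤ 1 - ν.real (Set.Iic u) := fun u => sub_nonneg.2 measureReal_le_one
  have hF1 : ∀ u, 1 - ν.real (Set.Iic u) ≤ 1 := fun u => sub_le_self _ measureReal_nonneg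
  have hbd : ∀ {f : (Fin d → ℝ) × (Fin d → ℝ) → ℝ}, Measurable f → (∀ p, 0 ≤ f p) →
      (∀ p, f p ≤ 1) → Integrable f (ν.prod ν) := fun hf h0 h1 =>
    Integrable.of_bound hf.aestronglyMeasurable 1 (Filter.Eventually.of_forall fun p => by
      rw [Real.norm_of_nonneg (h0 _)]; exact h1 _)
  have hsq : uncoveredProb ν m ^ 2 = ∫ p, ((1 - ν.real (Set.Iic p.1))
      * (1 - ν.real (Set.Iic p.2))) ^ m ∂(ν.prod ν) := by
    simp_rw [mul_pow]
    rw [integral_prod_mul (fun u => (1 - ν.real (Set.Iic u)) ^ m)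
      (fun u => (1 - ν.real (Set.Iic u)) ^ m), sq]
    rfl
  have hmF := measurable_measureReal_Iic ν
  have hmb := measurable_pairAvoid ν
  have hma : Measurable fun p : (Fin d → ℝ) × (Fin d → ℝ) =>
      ((1 - ν.real (Set.Iic p.1)) * (1 - ν.real (Set.Iic p.2))) ^ m :=
    (((hmF.comp measurable_fst).const_sub 1).mul
      ((hmF.comp measurable_snd).const_sub 1)).pow_const m
  rw [hsq, pairUncoveredProb, ← integral_sub, sharedCover, ← integral_const_mul]
  · refine integral_mono (Integrable.sub ?_ ?_) (Integrable.const_mul ?_ _) fun p => ?_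
    · exact hbd (hmb.pow_const m) (fun p => pow_nonneg (pairAvoid_nonneg ν _ _) m)
        fun p => pow_le_one₀ (pairAvoid_nonneg ν _ _) (pairAvoid_le_one ν _ _)
    · exact hbd hma (fun p => pow_nonneg (mul_nonneg (hF0 _) (hF0 _)) m)
        fun p => pow_le_one₀ (mul_nonneg (hF0 _) (hF0 _))
          (mul_le_one₀ (hF1 _) (hF0 _) (hF1 _))
    · exact hbd ((measurable_measureReal_Iic_inf ν).mul (hmb.pow_const _))
        (fun p => mul_nonneg measureReal_nonneg (pow_nonneg (pairAvoid_nonneg ν _ _) _))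
        fun p => mul_le_one₀ measureReal_le_one (pow_nonneg (pairAvoid_nonneg ν _ _) _)
          (pow_le_one₀ (pairAvoid_nonneg ν _ _) (pairAvoid_le_one ν _ _))
    · have hba : pairAvoid ν p.1 p.2 - (1 - ν.real (Set.Iic p.1)) * (1 - ν.real (Set.Iic p.2))
          = ν.real (Set.Iic (p.1 ⊓ p.2)) - ν.real (Set.Iic p.1) * ν.real (Set.Iic p.2) := by
        rw [pairAvoid]; ring
      refine (pow_sub_pow_le_mul (mul_nonneg (hF0 _) (hF0 _))
        (sub_nonneg.1 (hba ▸ sub_nonneg.2 (hassoc _ _))) m).trans ?_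
      rw [hba]
      gcongr
      · exact pow_nonneg (pairAvoid_nonneg ν _ _) _
      · exact sub_le_self _ (mul_nonneg measureReal_nonneg measureReal_nonneg)
  · exact hbd (hmb.pow_const m) (fun p => pow_nonneg (pairAvoid_nonneg ν _ _) m)
      fun p => pow_le_one₀ (pairAvoid_nonneg ν _ _) (pairAvoid_le_one ν _ _)
  · exact hbd hma (fun p => pow_nonneg (mul_nonneg (hF0 _) (hF0 _)) m)
      fun p => pow_le_one₀ (mul_nonneg (hF0 _) (hF0 _)) (mul_le_one₀ (hF1 _) (hF0 _) (hF1 _))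

/-! ### Integrals over the unit cube -/

/-- The uniform distribution on the unit interval. The interval is taken half-open, so that its
points are positive. -/
noncomputable def unif : Measure ℝ := volume.restrict (Set.Ioc 0 1)

instance : IsProbabilityMeasure unif := ⟨by simp [unif]⟩

/-- The uniform distribution on the `d`-dimensional unit cube. -/
noncomputable def cube (d : ℕ) : Measure (Fin d → ℝ) := Measure.pi fun _ => unif

instance (d : ℕ) : IsProbabilityMeasure (cube d) := by unfold cube; infer_instance

lemma ae_unif : ∀ᵐ x ∂unif, x ∈ Set.Ioc (0 : ℝ) 1 := ae_restrict_mem measurableSet_Ioc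

lemma ae_cube (d : ℕ) : ∀ᵐ y ∂(cube d), ∀ a, y a ∈ Set.Ioc (0 : ℝ) 1 := by
  refine ae_all_iff.2 fun a => ?_
  exact (measurePreserving_eval (fun _ : Fin d => unif) a).quasiMeasurePreserving.ae ae_unif

lemma prod_mem_Ioc {ι : Type*} [Fintype ι] {y : ι → ℝ} (hy : ∀ a, y a ∈ Set.Ioc (0 : ℝ) 1) :
    ∏ a, y a ∈ Set.Ioc (0 : ℝ) 1 :=
  ⟨Finset.prod_pos fun a _ => (hy a).1,
    Finset.prod_le_one (fun a _ => (hy a).1.le) fun a _ => (hy a).2⟩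

lemma measurable_prod_coord (d : ℕ) : Measurable fun y : Fin d → ℝ => ∏ a, y a := by fun_prop

lemma lintegral_cube_succ {d : ℕ} {g : ℝ → ENNReal} (hg : Measurable g) :
    ∫⁻ y, g (∏ a, y a) ∂(cube (d + 1)) = ∫⁻ y, ∫⁻ x, g ((∏ a, y a) * x) ∂unif ∂(cube d) := by
  have h := measurePreserving_piFinSuccAbove (fun _ : Fin (d + 1) => unif) 0
  have hmeas : Measurable fun p : ℝ × (Fin d → ℝ) => g ((∏ a, p.2 a) * p.1) :=
    hg.comp (((measurable_prod_coord d).comp measurable_snd).mul measurable_fst)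
  have h2 := h.lintegral_comp (f := fun p => g ((∏ a, p.2 a) * p.1)) hmeas
  rw [lintegral_prod_symm _ hmeas.aemeasurable] at h2
  refine Eq.trans ?_ h2
  refine lintegral_congr fun y => ?_
  rw [Fin.prod_univ_succAbove y 0, mul_comm]
  rfl

lemma lintegral_cube_prod {d : ℕ} {f : Fin d → ℝ → ENNReal} (hf : ∀ a, Measurable (f a)) :
    ∫⁻ y, ∏ a, f a (y a) ∂(cube d) = ∏ a, ∫⁻ x, f a x ∂unif := by
  have hind := iIndepFun_pi (μ := fun _ : Fin d => unif) (X := f) fun a => (hf a).aemeasurable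
  have h := lintegral_prod_eq_prod_lintegral_of_indepFun Finset.univ
    (fun a (y : Fin d → ℝ) => f a (y a)) hind fun a => (hf a).comp (measurable_pi_apply a)
  refine h.trans (Finset.prod_congr rfl fun a _ => ?_)
  exact (measurePreserving_eval (fun _ : Fin d => unif) a).lintegral_comp (hf a)

lemma lintegral_Ioc_rpow {r p : ℝ} (hr : 0 ≤ r) (hp : -1 < p) :
    ∫⁻ x in Set.Ioc 0 r, ENNReal.ofReal (x ^ p) = ENNReal.ofReal (r ^ (p + 1) / (p + 1)) := by
  rw [← ofReal_integral_eq_lintegral_ofReal, ← intervalIntegral.integral_of_le hr,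
    integral_rpow (Or.inl hp), Real.zero_rpow (by linarith), sub_zero]
  · exact (intervalIntegral.intervalIntegrable_rpow' hp).1
  · exact (ae_restrict_mem measurableSet_Ioc).mono fun x hx => Real.rpow_nonneg hx.1.le p

lemma lintegral_Ioi_rpow {r p : ℝ} (hr : 0 < r) (hp : p < -1) :
    ∫⁻ x in Set.Ioi r, ENNReal.ofReal (x ^ p) = ENNReal.ofReal (-r ^ (p + 1) / (p + 1)) := by
  rw [← ofReal_integral_eq_lintegral_ofReal, integral_Ioi_rpow_of_lt hp hr]
  · exact integrableOn_Ioi_rpow_of_lt hp hr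
  · exact (ae_restrict_mem measurableSet_Ioi).mono fun x hx =>
      Real.rpow_nonneg (hr.trans hx).le p

/-- The measure of the part of the cube where `∏ y ≤ 1 / t`. -/
noncomputable def lowVolume (d : ℕ) (t : ℝ) : ENNReal := cube d {y | t * ∏ a, y a ≤ 1}

/-- The function `x ↦ x ^ (-1/2)` on `x ≤ 1`, extended by zero. -/
noncomputable def nearWeight (x : ℝ) : ENNReal :=
  (Set.Iic (1 : ℝ)).indicator (fun x => ENNReal.ofReal (x ^ (-(1 / 2) : ℝ))) x

/-- The function `x ↦ x ^ (-2)` on `x > 1`, extended by zero. -/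
noncomputable def farWeight (x : ℝ) : ENNReal :=
  (Set.Ioi (1 : ℝ)).indicator (fun x => ENNReal.ofReal (x ^ (-2 : ℝ))) x

lemma measurable_nearWeight : Measurable nearWeight :=
  Measurable.indicator (by fun_prop) measurableSet_Iic

lemma measurable_farWeight : Measurable farWeight :=
  Measurable.indicator (by fun_prop) measurableSet_Ioi

lemma unif_mul_le_one {c : ℝ} (hc : 0 < c) :
    unif {x | c * x ≤ 1} = ENNReal.ofReal (min 1 c⁻¹) := by
  have hset : {x : ℝ | c * x ≤ 1} = Set.Iic c⁻¹ := by
    ext x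
    rw [Set.mem_ofPred_eq, Set.mem_Iic, ← one_div, le_div_iff₀' hc]
  rw [hset, unif, Measure.restrict_apply measurableSet_Iic, Set.inter_comm, Set.Ioc_inter_Iic,
    Real.volume_Ioc, sub_zero]

lemma lintegral_unif_nearWeight {c : ℝ} (hc : 0 < c) :
    ∫⁻ x, nearWeight (c * x) ∂unif ≤ 2 * unif {x | c * x ≤ 1} + 2 * nearWeight c := by
  have hr : 0 ≤ min 1 c⁻¹ := le_min zero_le_one (inv_nonneg.2 hc.le)
  have hcalc : ∫⁻ x, nearWeight (c * x) ∂unif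
      = ENNReal.ofReal (2 * (c ^ (-(1 / 2) : ℝ) * (min 1 c⁻¹) ^ (1 / 2 : ℝ))) := by
    have h1 : ∫⁻ x, nearWeight (c * x) ∂unif = ∫⁻ x, (Set.Ioc 0 (min 1 c⁻¹)).indicator
        (fun x => ENNReal.ofReal (c ^ (-(1 / 2) : ℝ)) * ENNReal.ofReal (x ^ (-(1 / 2) : ℝ))) x := by
      rw [unif, ← lintegral_indicator measurableSet_Ioc]
      refine lintegral_congr fun x => ?_
      have hiff : c * x ≤ 1 ↔ x ≤ c⁻¹ := by
        rw [← one_div, le_div_iff₀' hc]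
      simp only [Set.indicator_apply, Set.mem_Ioc, nearWeight, Set.mem_Iic, le_min_iff, hiff]
      by_cases h0 : 0 < x <;> by_cases hx1 : x ≤ 1 <;> by_cases hxc : x ≤ c⁻¹ <;>
        simp [h0, hx1, hxc, Real.mul_rpow hc.le (le_of_lt _),
          ENNReal.ofReal_mul (Real.rpow_nonneg hc.le _)]
    rw [h1, lintegral_indicator measurableSet_Ioc, lintegral_const_mul _ (by fun_prop),
      lintegral_Ioc_rpow hr (by norm_num), ← ENNReal.ofReal_mul (Real.rpow_nonneg hc.le _)]
    congr 1
    norm_num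
    ring
  rw [hcalc]
  rcases le_or_gt c 1 with h | h
  · refine le_add_left ?_
    rw [nearWeight, Set.indicator_of_mem (Set.mem_Iic.2 h), min_eq_left ((one_le_inv₀ hc).2 h),
      Real.one_rpow, mul_one, ENNReal.ofReal_mul zero_le_two, ENNReal.ofReal_ofNat]
  · refine le_add_right ?_
    have hcc : c ^ (-(1 / 2) : ℝ) * c⁻¹ ^ (1 / 2 : ℝ) = c⁻¹ := by
      rw [Real.inv_rpow hc.le, ← Real.rpow_neg hc.le, ← Real.rpow_add hc, ← Real.rpow_neg_one]
      norm_num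
    rw [unif_mul_le_one hc, min_eq_right (inv_le_one_of_one_le₀ h.le), hcc,
      ENNReal.ofReal_mul zero_le_two, ENNReal.ofReal_ofNat]

lemma lintegral_unif_farWeight {c : ℝ} (hc : 0 < c) :
    ∫⁻ x, farWeight (c * x) ∂unif ≤ unif {x | c * x ≤ 1} := by
  rcases le_or_gt c 1 with h | h
  · have hzero : ∫⁻ x, farWeight (c * x) ∂unif = 0 := by
      rw [← lintegral_zero (μ := unif)]
      refine lintegral_congr_ae ?_
      filter_upwards [ae_unif] with x hx
      exact Set.indicator_of_notMem (not_lt.2 (mul_le_one₀ h hx.1.le hx.2)) _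
    rw [hzero]
    exact zero_le
  · have hc' : 0 < c⁻¹ := inv_pos.2 hc
    calc ∫⁻ x, farWeight (c * x) ∂unif
        ≤ ∫⁻ x, (Set.Ioi c⁻¹).indicator
          (fun x => ENNReal.ofReal (c ^ (-2 : ℝ)) * ENNReal.ofReal (x ^ (-2 : ℝ))) x := by
          refine (lintegral_mono' Measure.restrict_le_self le_rfl).trans_eq
            (lintegral_congr fun x => ?_)
          have hiff : 1 < c * x ↔ c⁻¹ < x := by
            rw [← one_div, div_lt_iff₀' hc]
          simp only [Set.indicator_apply, farWeight, Set.mem_Ioi, hiff]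
          by_cases hx : c⁻¹ < x
          · rw [if_pos hx, if_pos hx, Real.mul_rpow hc.le (hc'.trans hx).le,
              ENNReal.ofReal_mul (Real.rpow_nonneg hc.le _)]
          · rw [if_neg hx, if_neg hx]
      _ = unif {x | c * x ≤ 1} := by
          rw [lintegral_indicator measurableSet_Ioi, lintegral_const_mul _ (by fun_prop),
            lintegral_Ioi_rpow hc' (by norm_num), ← ENNReal.ofReal_mul (Real.rpow_nonneg hc.le _),
            unif_mul_le_one hc, min_eq_right (inv_le_one_of_one_le₀ h.le)]
          congr 1
          have h1 : (-2 + 1 : ℝ) = -1 := by norm_num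
          have h2 : c ^ (-2 : ℝ) * c = c⁻¹ := by
            nth_rewrite 2 [← Real.rpow_one c]
            rw [← Real.rpow_add hc, ← Real.rpow_neg_one]
            norm_num
          rw [h1, Real.rpow_neg_one, inv_inv, neg_div_neg_eq, div_one, h2]

lemma measurableSet_mul_prod_le (d : ℕ) (t : ℝ) :
    MeasurableSet {y : Fin d → ℝ | t * ∏ a, y a ≤ 1} :=
  measurableSet_le ((measurable_prod_coord d).const_mul t) measurable_const

/-- Slicing along one coordinate. -/
lemma lowVolume_succ (d : ℕ) (t : ℝ) :
    lowVolume (d + 1) t = ∫⁻ y, unif {x | t * (∏ a, y a) * x ≤ 1} ∂(cube d) := by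
  have hg : Measurable ((Set.Iic (1 : ℝ)).indicator (1 : ℝ → ENNReal) ∘ fun x => t * x) :=
    (measurable_one.indicator measurableSet_Iic).comp (measurable_const_mul t)
  have h := lintegral_cube_succ (d := d) hg
  rw [lowVolume, ← lintegral_indicator_one (measurableSet_mul_prod_le (d + 1) t)]
  refine Eq.trans (lintegral_congr fun y => ?_) (h.trans (lintegral_congr fun y => ?_))
  · simp [Set.indicator_apply]
  · have hm : MeasurableSet {x : ℝ | t * (∏ a, y a) * x ≤ 1} :=
      measurableSet_le (measurable_const_mul _) measurable_const
    rw [← lintegral_indicator_one hm]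
    refine lintegral_congr fun x => ?_
    simp [Set.indicator_apply, mul_assoc]

lemma lowVolume_le_succ (d : ℕ) (t : ℝ) : lowVolume d t ≤ lowVolume (d + 1) t := by
  rw [lowVolume_succ, lowVolume, ← lintegral_indicator_one (measurableSet_mul_prod_le d t)]
  refine lintegral_mono_ae ?_
  filter_upwards [ae_cube d] with y hy
  by_cases hty : t * ∏ a, y a ≤ 1
  · have hone : unif {x | t * (∏ a, y a) * x ≤ 1} = 1 := by
      have hm : MeasurableSet {x : ℝ | t * (∏ a, y a) * x ≤ 1} :=
        measurableSet_le (measurable_const_mul _) measurable_const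
      refine (mem_ae_iff_prob_eq_one hm).1 ?_
      filter_upwards [ae_unif] with x hx
      exact mul_le_one₀ hty hx.1.le hx.2
    rw [hone]
    exact Set.indicator_le_self' (fun _ _ => zero_le) y
  · rw [Set.indicator_of_notMem (by exact hty)]
    exact zero_le

/-- One coordinate is integrated out at a time; the error term of the one-dimensional estimate is
the same integral in one dimension less. -/
lemma lintegral_cube_nearWeight {t : ℝ} (ht : 1 ≤ t) (d : ℕ) :
    ∫⁻ y, nearWeight (t * ∏ a, y a) ∂(cube d) ≤ 4 ^ d * lowVolume d t := by
  have ht0 : 0 < t := zero_lt_one.trans_le ht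
  induction d with
  | zero =>
    have hle : nearWeight t ≤ (Set.Iic (1 : ℝ)).indicator 1 t := by
      refine Set.indicator_le_indicator ?_
      rw [Pi.one_apply, ← ENNReal.ofReal_one]
      exact ENNReal.ofReal_le_ofReal (Real.rpow_le_one_of_one_le_of_nonpos ht (by norm_num))
    rw [lowVolume, ← lintegral_indicator_one (measurableSet_mul_prod_le 0 t), pow_zero, one_mul]
    refine lintegral_mono fun y => ?_
    simpa [Set.indicator_apply] using hle
  | succ d ih =>
    rw [lintegral_cube_succ (g := fun x => nearWeight (t * x))
      (measurable_nearWeight.comp (measurable_const_mul t))]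
    calc ∫⁻ y, ∫⁻ x, nearWeight (t * ((∏ a, y a) * x)) ∂unif ∂(cube d)
        ≤ ∫⁻ y, 2 * unif {x | t * (∏ a, y a) * x ≤ 1} + 2 * nearWeight (t * ∏ a, y a)
            ∂(cube d) := by
          refine lintegral_mono_ae ?_
          filter_upwards [ae_cube d] with y hy
          simp_rw [← mul_assoc t]
          exact lintegral_unif_nearWeight (mul_pos ht0 (prod_mem_Ioc hy).1)
      _ = 2 * lowVolume (d + 1) t + 2 * ∫⁻ y, nearWeight (t * ∏ a, y a) ∂(cube d) := by
          have hm : Measurable fun y : Fin d → ℝ => nearWeight (t * ∏ a, y a) :=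
            measurable_nearWeight.comp ((measurable_prod_coord d).const_mul t)
          rw [lintegral_add_right _ (hm.const_mul 2), lintegral_const_mul _ hm,
            lintegral_const_mul' _ _ ENNReal.ofNat_ne_top, lowVolume_succ]
      _ ≤ 2 * 4 ^ d * lowVolume (d + 1) t + 2 * (4 ^ d * lowVolume (d + 1) t) := by
          gcongr ?_ * _ + 2 * ?_
          · exact le_mul_of_one_le_right (by norm_num) (one_le_pow₀ (by norm_num))
          · exact ih.trans (by gcongr; exact lowVolume_le_succ d t)
      _ = 4 ^ (d + 1) * lowVolume (d + 1) t := by ring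

/-- Integrating out a single coordinate suffices here, as `farWeight` is integrable at infinity. -/
lemma lintegral_cube_farWeight {t : ℝ} (ht : 0 < t) (d : ℕ) :
    ∫⁻ y, farWeight (t * ∏ a, y a) ∂(cube (d + 1)) ≤ lowVolume (d + 1) t := by
  rw [lintegral_cube_succ (g := fun x => farWeight (t * x))
    (measurable_farWeight.comp (measurable_const_mul t)), lowVolume_succ]
  refine lintegral_mono_ae ?_
  filter_upwards [ae_cube d] with y hy
  simp_rw [← mul_assoc t]
  exact lintegral_unif_farWeight (mul_pos ht (prod_mem_Ioc hy).1)

lemma exp_neg_half_le_rpow {y α : ℝ} (hy : 0 < y) (h1 : 1 ≤ α) (h2 : α ≤ 2) :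
    Real.exp (-(y / 2)) ≤ 10 * y ^ (-α) := by
  have hpow : y ^ α ≤ y + y ^ 2 := by
    rcases le_or_gt y 1 with h | h
    · calc y ^ α ≤ y ^ (1 : ℝ) := Real.rpow_le_rpow_of_exponent_ge hy h h1
        _ = y := Real.rpow_one y
        _ ≤ y + y ^ 2 := le_add_of_nonneg_right (sq_nonneg y)
    · calc y ^ α ≤ y ^ (2 : ℝ) := Real.rpow_le_rpow_of_exponent_le h.le h2
        _ = y ^ 2 := Real.rpow_two y
        _ ≤ y + y ^ 2 := le_add_of_nonneg_left hy.le
  have hexp := Real.quadratic_le_exp_of_nonneg (half_pos hy).le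
  rw [Real.exp_neg, Real.rpow_neg hy.le, ← div_eq_mul_inv, inv_eq_one_div,
    div_le_div_iff₀ (Real.exp_pos _) (Real.rpow_pos_of_pos hy α), one_mul]
  nlinarith [sq_nonneg (y - 1)]

lemma lintegral_unif_Ici_rpow {x α : ℝ} (hx : 0 < x) (hα : 1 < α) :
    ∫⁻ u, (Set.Ici x).indicator (fun u => ENNReal.ofReal (u ^ (-α))) u ∂unif
      ≤ ENNReal.ofReal (x ^ (1 - α) / (α - 1)) := by
  refine (lintegral_mono' Measure.restrict_le_self le_rfl).trans_eq ?_
  rw [lintegral_indicator measurableSet_Ici, setLIntegral_congr Ioi_ae_eq_Ici.symm,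
    lintegral_Ioi_rpow hx (by linarith)]
  congr 1
  rw [show -α + 1 = -(α - 1) by ring, neg_div_neg_eq, neg_sub]

/-- The mean of `exp (-t ∏ u / 2)` over the part of the cube above `x`. -/
noncomputable def upperMass (d : ℕ) (t : ℝ) (x : Fin d → ℝ) : ENNReal :=
  ∫⁻ u, (Set.Ici x).indicator (fun u => ENNReal.ofReal (Real.exp (-(t * (∏ a, u a) / 2)))) u
    ∂(cube d)

/-- Bounding `exp` by a power makes the integrand a product of functions of one coordinate. -/
lemma upperMass_le_rpow {d : ℕ} {t α : ℝ} (ht : 0 < t) (h1 : 1 < α) (h2 : α ≤ 2)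
    {x : Fin d → ℝ} (hx : ∀ a, x a ∈ Set.Ioc (0 : ℝ) 1) :
    upperMass d t x
      ≤ ENNReal.ofReal (10 * t ^ (-α) * (((∏ a, x a) ^ (1 - α)) / (α - 1) ^ d)) := by
  have hα : 0 < α - 1 := sub_pos.2 h1
  have hmeas : ∀ a, Measurable fun s : ℝ =>
      (Set.Ici (x a)).indicator (fun u => ENNReal.ofReal (u ^ (-α))) s := fun a =>
    Measurable.indicator (by fun_prop) measurableSet_Ici
  calc upperMass d t x
      ≤ ∫⁻ u, ENNReal.ofReal (10 * t ^ (-α)) *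
          ∏ a, (Set.Ici (x a)).indicator (fun u => ENNReal.ofReal (u ^ (-α))) (u a)
          ∂(cube d) := by
        refine lintegral_mono_ae ?_
        filter_upwards [ae_cube d] with u hu
        refine Set.indicator_apply_le' (fun hxu => ?_) fun _ => zero_le
        have hprod : ∏ a, (Set.Ici (x a)).indicator (fun u => ENNReal.ofReal (u ^ (-α))) (u a)
            = ENNReal.ofReal ((∏ a, u a) ^ (-α)) := by
          rw [← Real.finsetProd_rpow _ _ fun a _ => (hu a).1.le,
            ENNReal.ofReal_prod_of_nonneg fun a _ => Real.rpow_nonneg (hu a).1.le _]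
          exact Finset.prod_congr rfl fun a _ => Set.indicator_of_mem (Set.mem_Ici.2 (hxu a)) _
        have hpos := (prod_mem_Ioc hu).1
        rw [hprod, ← ENNReal.ofReal_mul (by positivity), mul_assoc, ← Real.mul_rpow ht.le hpos.le]
        exact ENNReal.ofReal_le_ofReal (exp_neg_half_le_rpow (mul_pos ht hpos) h1.le h2)
    _ = ENNReal.ofReal (10 * t ^ (-α)) *
          ∏ a, ∫⁻ u, (Set.Ici (x a)).indicator (fun u => ENNReal.ofReal (u ^ (-α))) u ∂unif := by
        rw [lintegral_const_mul' _ _ ENNReal.ofReal_ne_top, lintegral_cube_prod hmeas]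
    _ ≤ ENNReal.ofReal (10 * t ^ (-α)) *
          ∏ a, ENNReal.ofReal ((x a) ^ (1 - α) / (α - 1)) := by
        gcongr with a
        exact lintegral_unif_Ici_rpow (hx a).1 h1
    _ = ENNReal.ofReal (10 * t ^ (-α) * (((∏ a, x a) ^ (1 - α)) / (α - 1) ^ d)) := by
        rw [← ENNReal.ofReal_prod_of_nonneg fun a _ =>
          div_nonneg (Real.rpow_nonneg (hx a).1.le _) hα.le, ← ENNReal.ofReal_mul (by positivity),
          Finset.prod_div_distrib, Real.finsetProd_rpow _ _ fun a _ => (hx a).1.le]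
        simp

/-- The exponents `5 / 4` and `2` in `upperMass_le_rpow` give the bounds near the lower boundary of
the cube and away from it. -/
lemma upperMass_sq_le {d : ℕ} {t : ℝ} (ht : 0 < t) {x : Fin d → ℝ}
    (hx : ∀ a, x a ∈ Set.Ioc (0 : ℝ) 1) :
    upperMass d t x ^ 2 ≤ ENNReal.ofReal (100 * 16 ^ d * t⁻¹ ^ 2) *
      (nearWeight (t * ∏ a, x a) + farWeight (t * ∏ a, x a)) := by
  have hpos := (prod_mem_Ioc hx).1
  set q := ∏ a, x a
  have htq : 0 < t * q := mul_pos ht hpos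
  have key : ∀ {α : ℝ}, t ^ (-α) * q ^ (1 - α) = t⁻¹ * (t * q) ^ (1 - α) := by
    intro α
    rw [Real.mul_rpow ht.le hpos.le, ← mul_assoc, ← Real.rpow_neg_one, ← Real.rpow_add ht]
    congr 2
    ring
  rcases le_or_gt (t * q) 1 with h | h
  · refine le_trans ?_ (mul_le_mul_right (le_add_right le_rfl) _)
    refine (pow_le_pow_left' (upperMass_le_rpow ht (α := 5 / 4) (by norm_num) (by norm_num) hx)
      2).trans_eq ?_
    rw [nearWeight, Set.indicator_of_mem (Set.mem_Iic.2 h), ← ENNReal.ofReal_mul (by positivity),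
      ← ENNReal.ofReal_pow (by positivity)]
    congr 1
    have hsq : ((t * q) ^ (1 - 5 / 4 : ℝ)) ^ 2 = (t * q) ^ (-(1 / 2) : ℝ) := by
      rw [← Real.rpow_natCast, ← Real.rpow_mul htq.le]
      norm_num
    have h4 : (5 / 4 - 1 : ℝ) ^ d = (4 ^ d)⁻¹ := by rw [← inv_pow]; norm_num
    have h16 : (16 : ℝ) ^ d = (4 ^ d) ^ 2 := by rw [← pow_mul, mul_comm d 2, pow_mul]; norm_num
    rw [mul_assoc 10, ← mul_div_assoc, key, h4, h16, ← hsq]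
    field_simp
    norm_num
  · refine le_trans ?_ (mul_le_mul_right (le_add_left le_rfl) _)
    refine (pow_le_pow_left' (upperMass_le_rpow ht (α := 2) (by norm_num) (by norm_num) hx)
      2).trans ?_
    rw [farWeight, Set.indicator_of_mem (Set.mem_Ioi.2 h), ← ENNReal.ofReal_mul (by positivity),
      ← ENNReal.ofReal_pow (by positivity)]
    refine ENNReal.ofReal_le_ofReal ?_
    have hsq : ((t * q) ^ (1 - 2 : ℝ)) ^ 2 = (t * q) ^ (-2 : ℝ) := by
      rw [← Real.rpow_natCast, ← Real.rpow_mul htq.le]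
      norm_num
    have h16 : (1 : ℝ) ≤ 16 ^ d := one_le_pow₀ (by norm_num)
    rw [mul_assoc 10, ← mul_div_assoc, key, show (2 - 1 : ℝ) = 1 by norm_num, one_pow, div_one,
      mul_pow, mul_pow, hsq, ← mul_assoc]
    have : (10 : ℝ) ^ 2 * t⁻¹ ^ 2 ≤ 100 * 16 ^ d * t⁻¹ ^ 2 := by
      gcongr
      linarith
    gcongr

/-- The second moment of `upperMass`, with the optimal power of `t` in front of `lowVolume`. -/
lemma lintegral_upperMass_sq_le {t : ℝ} (ht : 1 ≤ t) {d : ℕ} (hd : 1 ≤ d) :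
    ∫⁻ x, upperMass d t x ^ 2 ∂(cube d)
      ≤ ENNReal.ofReal (200 * 64 ^ d * t⁻¹ ^ 2) * lowVolume d t := by
  have ht0 : 0 < t := zero_lt_one.trans_le ht
  have hmn : Measurable fun x : Fin d → ℝ => nearWeight (t * ∏ a, x a) :=
    measurable_nearWeight.comp ((measurable_prod_coord d).const_mul t)
  calc ∫⁻ x, upperMass d t x ^ 2 ∂(cube d)
      ≤ ∫⁻ x, ENNReal.ofReal (100 * 16 ^ d * t⁻¹ ^ 2) *
        (nearWeight (t * ∏ a, x a) + farWeight (t * ∏ a, x a)) ∂(cube d) := by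
        refine lintegral_mono_ae ?_
        filter_upwards [ae_cube d] with x hx
        exact upperMass_sq_le ht0 hx
    _ ≤ ENNReal.ofReal (100 * 16 ^ d * t⁻¹ ^ 2) * (4 ^ d * lowVolume d t + lowVolume d t) := by
        rw [lintegral_const_mul' _ _ ENNReal.ofReal_ne_top, lintegral_add_left hmn]
        gcongr
        · exact lintegral_cube_nearWeight ht d
        · obtain ⟨k, rfl⟩ := Nat.exists_eq_add_of_le' hd
          exact lintegral_cube_farWeight ht0 k
    _ ≤ ENNReal.ofReal (100 * 16 ^ d * t⁻¹ ^ 2) * (2 * 4 ^ d * lowVolume d t) := by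
        gcongr
        rw [mul_assoc, two_mul]
        gcongr
        exact le_mul_of_one_le_left zero_le (one_le_pow₀ (by norm_num))
    _ = ENNReal.ofReal (200 * 64 ^ d * t⁻¹ ^ 2) * lowVolume d t := by
        have h4 : (2 * 4 ^ d : ENNReal) = ENNReal.ofReal (2 * 4 ^ d) := by
          rw [ENNReal.ofReal_mul zero_le_two, ENNReal.ofReal_pow (by norm_num)]
          simp
        have h64 : (64 : ℝ) ^ d = 16 ^ d * 4 ^ d := by rw [← mul_pow]; norm_num
        rw [← mul_assoc, h4, ← ENNReal.ofReal_mul (by positivity), h64]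
        congr 2
        ring

lemma measurable_upperMass (d : ℕ) (t : ℝ) : Measurable (upperMass d t) := by
  have hset : MeasurableSet {p : (Fin d → ℝ) × (Fin d → ℝ) | p.1 ≤ p.2} :=
    measurableSet_le measurable_fst measurable_snd
  have hf : Measurable fun p : (Fin d → ℝ) × (Fin d → ℝ) =>
      ENNReal.ofReal (Real.exp (-(t * (∏ a, p.2 a) / 2))) := by fun_prop
  exact (hf.indicator hset).lintegral_prod_right' (ν := cube d)

/-! ### Lower bounds for the uncovered probability -/

/-- A quantitative form of `(1 - 1 / m) ^ m → 1 / e`, with room to spare for small `m`. -/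
lemma exp_neg_two_le_pow {x : ℝ} {k m : ℕ} (hm : 2 ≤ m) (hk : k ≤ m) (hx : m * x ≤ 1) :
    Real.exp (-2) ≤ (1 - x) ^ k := by
  have hm' : (2 : ℝ) ≤ m := by exact_mod_cast hm
  have hm0 : (0 : ℝ) < m := by linarith
  have hx' : x ≤ (m : ℝ)⁻¹ := by rw [← one_div, le_div_iff₀' hm0]; exact hx
  have hinv : (m : ℝ)⁻¹ ≤ 1 / 2 := by
    rw [← one_div]
    exact one_div_le_one_div_of_le two_pos hm'
  have hpos : 0 < 1 - (m : ℝ)⁻¹ := by linarith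
  have hlog := Real.one_sub_inv_le_log_of_pos hpos
  have hval : -2 ≤ m * (1 - (1 - (m : ℝ)⁻¹)⁻¹) := by
    have h1 : m * (1 - (1 - (m : ℝ)⁻¹)⁻¹) = -(1 - (m : ℝ)⁻¹)⁻¹ := by
      have : (m : ℝ) - 1 ≠ 0 := by linarith
      field_simp
      ring
    rw [h1, neg_le_neg_iff, inv_le_comm₀ hpos two_pos]
    linarith
  calc Real.exp (-2) ≤ Real.exp (m * Real.log (1 - (m : ℝ)⁻¹)) :=
        Real.exp_le_exp.2 (hval.trans (mul_le_mul_of_nonneg_left hlog hm0.le))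
    _ = (1 - (m : ℝ)⁻¹) ^ m := by
        rw [mul_comm, ← Real.rpow_def_of_pos hpos, Real.rpow_natCast]
    _ ≤ (1 - (m : ℝ)⁻¹) ^ k :=
        pow_le_pow_of_le_one hpos.le (sub_le_self _ (inv_nonneg.2 hm0.le)) hk
    _ ≤ (1 - x) ^ k := by gcongr

lemma integrable_one_sub_prod_pow (d k : ℕ) :
    Integrable (fun y : Fin d → ℝ => (1 - ∏ a, y a) ^ k) (cube d) := by
  refine Integrable.of_bound (C := 1) (by fun_prop) ?_
  filter_upwards [ae_cube d] with y hy
  have h := prod_mem_Ioc hy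
  rw [Real.norm_of_nonneg (pow_nonneg (sub_nonneg.2 h.2) k)]
  exact pow_le_one₀ (sub_nonneg.2 h.2) (sub_le_self _ h.1.le)

/-- On the region `∏ y ≤ 1 / m` the integrand is bounded below. -/
lemma lowVolume_le_integral {d k m : ℕ} (hm : 2 ≤ m) (hk : k ≤ m) :
    Real.exp (-2) * (lowVolume d m).toReal ≤ ∫ y, (1 - ∏ a, y a) ^ k ∂(cube d) := by
  have hS := measurableSet_mul_prod_le d m
  have h1 : Real.exp (-2) * (lowVolume d m).toReal
      = ∫ y, {y : Fin d → ℝ | m * ∏ a, y a ≤ 1}.indicator (fun _ => Real.exp (-2)) y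
        ∂(cube d) := by
    rw [integral_indicator_const _ hS, smul_eq_mul, mul_comm]
    rfl
  rw [h1]
  refine integral_mono_ae ((integrable_const _).indicator hS)
    (integrable_one_sub_prod_pow d k) ?_
  filter_upwards [ae_cube d] with y hy
  refine Set.indicator_apply_le' (fun h => exp_neg_two_le_pow hm hk h) fun _ => ?_
  exact pow_nonneg (sub_nonneg.2 (prod_mem_Ioc hy).2) k

lemma lowVolume_ne_top (d : ℕ) (t : ℝ) : lowVolume d t ≠ ⊤ := measure_ne_top _ _

/-- In two dimensions the region `∏ y ≤ 1 / t` contains, above `x > 1 / t`, a segment of length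
`1 / (t x)`; further attributes only enlarge the region. -/
lemma log_div_le_lowVolume {t : ℝ} (ht : 1 ≤ t) {d : ℕ} (hd : 2 ≤ d) :
    ENNReal.ofReal (Real.log t / t) ≤ lowVolume d t := by
  have ht0 : 0 < t := zero_lt_one.trans_le ht
  induction d, hd using Nat.le_induction with
  | base =>
    have hg : Measurable fun x : ℝ => unif {z | t * x * z ≤ 1} := by
      have hset : MeasurableSet {p : ℝ × ℝ | t * p.1 * p.2 ≤ 1} :=
        measurableSet_le ((measurable_fst.const_mul t).mul measurable_snd) measurable_const
      exact measurable_measure_prodMk_left hset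
    have h1 : lowVolume 2 t = ∫⁻ x, unif {z | t * x * z ≤ 1} ∂unif := by
      rw [lowVolume_succ, lintegral_cube_succ (d := 0) hg]
      simp
    have ht1 : t⁻¹ ≤ 1 := inv_le_one_of_one_le₀ ht
    have hint : IntervalIntegrable (fun x : ℝ => t⁻¹ * x⁻¹) volume t⁻¹ 1 := by
      refine (intervalIntegral.intervalIntegrable_inv (fun x hx => ?_) continuousOn_id).const_mul _
      rw [Set.uIcc_of_le ht1] at hx
      exact ((inv_pos.2 ht0).trans_le hx.1).ne'
    have h2 : ENNReal.ofReal (Real.log t / t)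
        = ∫⁻ x in Set.Ioc t⁻¹ 1, ENNReal.ofReal (t⁻¹ * x⁻¹) := by
      rw [← ofReal_integral_eq_lintegral_ofReal hint.1, ← intervalIntegral.integral_of_le ht1,
        intervalIntegral.integral_const_mul, integral_inv_of_pos (inv_pos.2 ht0) one_pos]
      · congr 1
        rw [one_div, inv_inv, div_eq_mul_inv, mul_comm]
      · exact (ae_restrict_mem measurableSet_Ioc).mono fun x hx =>
          mul_nonneg (inv_nonneg.2 ht0.le) (inv_nonneg.2 ((inv_pos.2 ht0).trans hx.1).le)
    rw [h1, h2, unif]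
    refine le_trans ?_ (lintegral_mono' (Measure.restrict_mono
      (Set.Ioc_subset_Ioc_left (inv_nonneg.2 ht0.le)) le_rfl) le_rfl)
    refine setLIntegral_mono hg fun x hx => ?_
    have hx0 : 0 < x := (inv_pos.2 ht0).trans hx.1
    have htx : 1 ≤ t * x := by
      have := mul_le_mul_of_nonneg_left hx.1.le ht0.le
      rwa [mul_inv_cancel₀ ht0.ne'] at this
    have h3 := unif_mul_le_one (mul_pos ht0 hx0)
    rw [min_eq_right (inv_le_one_of_one_le₀ htx), mul_inv] at h3
    exact h3.ge
  | succ d _ ih => exact ih.trans (lowVolume_le_succ d t)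

/-! ### Reduction to the unit cube -/

lemma continuous_cdf (μ : Measure ℝ) [IsProbabilityMeasure μ] [NullSingletonClass μ] :
    Continuous (cdf μ) := by
  refine continuous_iff_continuousAt.2 fun x => ?_
  have h : (cdf μ).measure {x} = 0 := by rw [measure_cdf]; exact measure_singleton x
  rw [StieltjesFunction.measure_singleton, ENNReal.ofReal_eq_zero, sub_nonpos] at h
  rw [(monotone_cdf μ).continuousAt_iff_leftLim_eq_rightLim, StieltjesFunction.rightLim_eq]
  exact le_antisymm ((monotone_cdf μ).leftLim_le le_rfl) h

/-- The probability integral transform. -/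
lemma map_cdf_eq_unif (μ : Measure ℝ) [IsProbabilityMeasure μ] [NullSingletonClass μ] :
    μ.map (cdf μ) = unif := by
  have hmeas : Measurable (cdf μ) := (monotone_cdf μ).measurable
  have hprob : IsProbabilityMeasure (μ.map (cdf μ)) :=
    Measure.isProbabilityMeasure_map hmeas.aemeasurable
  have hsurj : ∀ s ∈ Set.Ioo (0 : ℝ) 1, ∃ x, cdf μ x = s := by
    intro s hs
    obtain ⟨x, hx⟩ := ((tendsto_cdf_atBot μ).eventually (gt_mem_nhds hs.1)).exists
    obtain ⟨y, hy⟩ := ((tendsto_cdf_atTop μ).eventually (lt_mem_nhds hs.2)).exists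
    exact mem_range_of_exists_le_of_exists_ge (continuous_cdf μ) ⟨x, hx.le⟩ ⟨y, hy.le⟩
  have hle : ∀ s < 1, μ.real {x | cdf μ x ≤ s} ≤ max s 0 := by
    intro s hs
    refine le_of_forall_gt_imp_ge_of_dense fun r hr => ?_
    rcases le_or_gt 1 r with h | h
    · exact measureReal_le_one.trans h
    · have hr' := max_lt_iff.1 hr
      obtain ⟨x, hx⟩ := hsurj r ⟨hr'.2, h⟩
      rw [← hx, cdf_eq_real μ x]
      refine measureReal_mono fun y hy => ?_
      exact ((monotone_cdf μ).reflect_lt ((Set.mem_ofPred_eq ▸ hy).trans_lt (hx ▸ hr'.1))).le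
  refine Measure.ext_of_Iic _ _ fun s => ?_
  rw [Measure.map_apply hmeas measurableSet_Iic, unif, Measure.restrict_apply measurableSet_Iic,
    Set.inter_comm, Set.Ioc_inter_Iic, Real.volume_Ioc, sub_zero]
  change μ {x | cdf μ x ≤ s} = _
  rcases le_or_gt 1 s with h | h
  · have huniv : {x | cdf μ x ≤ s} = Set.univ :=
      Set.eq_univ_of_forall fun x => (cdf_le_one μ x).trans h
    rw [huniv, measure_univ, min_eq_left h, ENNReal.ofReal_one]
  · rw [min_eq_right h.le, ← ofReal_measureReal]
    rcases le_or_gt s 0 with h0 | h0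
    · rw [ENNReal.ofReal_of_nonpos h0, ENNReal.ofReal_of_nonpos]
      exact (hle s h).trans_eq (max_eq_right h0)
    · congr 1
      refine le_antisymm ((hle s h).trans_eq (max_eq_left h0.le)) ?_
      obtain ⟨x, hx⟩ := hsurj s ⟨h0, h⟩
      conv_lhs => rw [← hx, cdf_eq_real μ x]
      exact measureReal_mono fun y hy => (monotone_cdf μ hy).trans_eq hx

section Transform

variable {d : ℕ} (μ : Fin d → Measure ℝ)

/-- The map that applies to each attribute its cumulative distribution function. -/
noncomputable def cdfMap (y : Fin d → ℝ) : Fin d → ℝ := fun a => cdf (μ a) (y a)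

lemma cdfMap_mono : Monotone (cdfMap μ) := fun _ _ h a => monotone_cdf (μ a) (h a)

lemma measurable_cdfMap : Measurable (cdfMap μ) :=
  measurable_pi_lambda _ fun a =>
    (monotone_cdf (μ a)).measurable.comp (measurable_pi_apply a)

variable [∀ a, IsProbabilityMeasure (μ a)]

lemma measureReal_pi_Iic (u : Fin d → ℝ) :
    (Measure.pi μ).real (Set.Iic u) = ∏ a, cdfMap μ u a := by
  rw [← Set.pi_univ_Iic, measureReal_def, Measure.pi_pi, ENNReal.toReal_prod]
  exact Finset.prod_congr rfl fun a _ => (cdf_eq_real (μ a) (u a)).symm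

/-- Lower orthants are positively associated under a product measure. -/
lemma measureReal_pi_Iic_mul_le (u v : Fin d → ℝ) :
    (Measure.pi μ).real (Set.Iic u) * (Measure.pi μ).real (Set.Iic v)
      ≤ (Measure.pi μ).real (Set.Iic (u ⊓ v)) := by
  simp_rw [measureReal_pi_Iic, ← Finset.prod_mul_distrib]
  refine Finset.prod_le_prod (fun a _ => mul_nonneg (cdf_nonneg _ _) (cdf_nonneg _ _))
    fun a _ => ?_
  simp only [cdfMap, Pi.inf_apply]
  rcases le_total (u a) (v a) with h | h
  · rw [inf_eq_left.2 h]
    exact mul_le_of_le_one_right (cdf_nonneg _ _) (cdf_le_one _ _)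
  · rw [inf_eq_right.2 h]
    exact mul_le_of_le_one_left (cdf_nonneg _ _) (cdf_le_one _ _)

variable [∀ a, NullSingletonClass (μ a)]

lemma map_cdfMap : (Measure.pi μ).map (cdfMap μ) = cube d := by
  have hprob : ∀ a, IsProbabilityMeasure ((μ a).map (cdf (μ a))) := fun a =>
    Measure.isProbabilityMeasure_map (monotone_cdf (μ a)).measurable.aemeasurable
  refine (Measure.pi_map_pi fun a => (monotone_cdf (μ a)).measurable.aemeasurable).trans ?_
  simp_rw [map_cdf_eq_unif, cube]

lemma uncoveredProb_pi (m : ℕ) :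
    uncoveredProb (Measure.pi μ) m = ∫ y, (1 - ∏ a, y a) ^ m ∂(cube d) := by
  rw [← map_cdfMap μ, integral_map (measurable_cdfMap μ).aemeasurable (by fun_prop),
    uncoveredProb]
  simp_rw [measureReal_pi_Iic]

lemma lintegral_Ici_exp_le_upperMass (t : ℝ) (x : Fin d → ℝ) :
    ∫⁻ u, (Set.Ici x).indicator (fun u => ENNReal.ofReal
      (Real.exp (-(t * (Measure.pi μ).real (Set.Iic u) / 2)))) u ∂(Measure.pi μ)
      ≤ upperMass d t (cdfMap μ x) := by
  have hmeas : Measurable ((Set.Ici (cdfMap μ x)).indicator fun u =>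
      ENNReal.ofReal (Real.exp (-(t * (∏ a, u a) / 2)))) :=
    Measurable.indicator (by fun_prop) measurableSet_Ici
  rw [upperMass, ← map_cdfMap μ, lintegral_map hmeas (measurable_cdfMap μ)]
  refine lintegral_mono fun u => ?_
  refine Set.indicator_apply_le' (fun hu => ?_) fun _ => zero_le
  rw [Set.indicator_of_mem (Set.mem_Ici.2 (cdfMap_mono μ hu)), measureReal_pi_Iic]

end Transform

lemma pairAvoid_pow_le {d : ℕ} (ν : Measure (Fin d → ℝ)) [IsProbabilityMeasure ν]
    (u v : Fin d → ℝ) {m : ℕ} (hm : 1 ≤ m) :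
    pairAvoid ν u v ^ (m - 1) ≤ Real.exp 1 * (Real.exp (-(m * ν.real (Set.Iic u) / 2)) *
      Real.exp (-(m * ν.real (Set.Iic v) / 2))) := by
  have hu : ν.real (Set.Iic (u ⊓ v)) ≤ ν.real (Set.Iic u) :=
    measureReal_mono (Set.Iic_subset_Iic.2 inf_le_left)
  have hv : ν.real (Set.Iic (u ⊓ v)) ≤ ν.real (Set.Iic v) :=
    measureReal_mono (Set.Iic_subset_Iic.2 inf_le_right)
  have hu1 : ν.real (Set.Iic u) ≤ 1 := measureReal_le_one
  have hv1 : ν.real (Set.Iic v) ≤ 1 := measureReal_le_one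
  have h0 := pairAvoid_nonneg ν u v
  have hle : pairAvoid ν u v ≤ Real.exp (-((ν.real (Set.Iic u) + ν.real (Set.Iic v)) / 2)) := by
    refine le_trans ?_ (Real.add_one_le_exp _)
    rw [pairAvoid]
    linarith
  refine (pow_le_pow_left₀ h0 hle (m - 1)).trans ?_
  rw [← Real.exp_nat_mul, ← Real.exp_add, ← Real.exp_add, Nat.cast_sub hm, Nat.cast_one]
  refine Real.exp_le_exp.2 ?_
  linarith

/-- Conditioning on the dominating tuple turns the two dominated ones into independent copies. -/
lemma lintegral_shared_eq {d : ℕ} (ν : Measure (Fin d → ℝ)) [IsProbabilityMeasure ν]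
    {φ : (Fin d → ℝ) → ENNReal} (hφ : Measurable φ) :
    ∫⁻ p, ν (Set.Iic (p.1 ⊓ p.2)) * (φ p.1 * φ p.2) ∂(ν.prod ν)
      = ∫⁻ x, (∫⁻ u, (Set.Ici x).indicator φ u ∂ν) ^ 2 ∂ν := by
  have hset : MeasurableSet {q : ((Fin d → ℝ) × (Fin d → ℝ)) × (Fin d → ℝ) |
      q.2 ≤ q.1.1 ∧ q.2 ≤ q.1.2} :=
    (measurableSet_le measurable_snd (measurable_fst.comp measurable_fst)).inter
      (measurableSet_le measurable_snd (measurable_snd.comp measurable_fst))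
  have hφ2 : Measurable fun p : (Fin d → ℝ) × (Fin d → ℝ) => φ p.1 * φ p.2 :=
    (hφ.comp measurable_fst).mul (hφ.comp measurable_snd)
  have hmeas : Measurable ({q : ((Fin d → ℝ) × (Fin d → ℝ)) × (Fin d → ℝ) |
      q.2 ≤ q.1.1 ∧ q.2 ≤ q.1.2}.indicator fun q => φ q.1.1 * φ q.1.2) :=
    (hφ2.comp measurable_fst).indicator hset
  have hleft : ∀ p : (Fin d → ℝ) × (Fin d → ℝ), ν (Set.Iic (p.1 ⊓ p.2)) * (φ p.1 * φ p.2)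
      = ∫⁻ x, {q : ((Fin d → ℝ) × (Fin d → ℝ)) × (Fin d → ℝ) |
        q.2 ≤ q.1.1 ∧ q.2 ≤ q.1.2}.indicator (fun q => φ q.1.1 * φ q.1.2) (p, x) ∂ν := by
    intro p
    rw [mul_comm, ← lintegral_indicator_const measurableSet_Iic]
    refine lintegral_congr fun x => ?_
    by_cases h1 : x ≤ p.1 <;> by_cases h2 : x ≤ p.2 <;> simp [h1, h2]
  simp_rw [hleft]
  rw [lintegral_lintegral_swap (by exact hmeas.aemeasurable)]
  refine lintegral_congr fun x => ?_
  have hind : AEMeasurable ((Set.Ici x).indicator φ) ν :=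
    (hφ.indicator measurableSet_Ici).aemeasurable
  rw [sq, ← lintegral_prod_mul hind hind]
  refine lintegral_congr fun p => ?_
  by_cases h1 : x ≤ p.1 <;> by_cases h2 : x ≤ p.2 <;> simp [h1, h2]

/-- The main estimate: under component independence `sharedCover` is of order
`lowVolume / m ^ 2`. -/
lemma sharedCover_pi_le {d : ℕ} (hd : 1 ≤ d) (μ : Fin d → Measure ℝ)
    [∀ a, IsProbabilityMeasure (μ a)] [∀ a, NullSingletonClass (μ a)] {m : ℕ} (hm : 1 ≤ m) :
    sharedCover (Measure.pi μ) (m - 1)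
      ≤ Real.exp 1 * (200 * 64 ^ d) * ((lowVolume d m).toReal / m ^ 2) := by
  set ν := Measure.pi μ with hν
  have hm' : (1 : ℝ) ≤ m := by exact_mod_cast hm
  have hmF := measurable_measureReal_Iic ν
  have hφ : Measurable fun u : Fin d → ℝ =>
      ENNReal.ofReal (Real.exp (-(m * ν.real (Set.Iic u) / 2))) :=
    ((((hmF.const_mul _).div_const _).neg).exp).ennreal_ofReal
  have hbound : ∫⁻ p, ENNReal.ofReal (ν.real (Set.Iic (p.1 ⊓ p.2)) * pairAvoid ν p.1 p.2 ^ (m - 1))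
      ∂(ν.prod ν)
      ≤ ENNReal.ofReal (Real.exp 1 * (200 * 64 ^ d) * ((lowVolume d m).toReal / m ^ 2)) := by
    calc ∫⁻ p, ENNReal.ofReal
          (ν.real (Set.Iic (p.1 ⊓ p.2)) * pairAvoid ν p.1 p.2 ^ (m - 1)) ∂(ν.prod ν)
        ≤ ∫⁻ p, ENNReal.ofReal (Real.exp 1) * (ν (Set.Iic (p.1 ⊓ p.2)) *
          (ENNReal.ofReal (Real.exp (-(m * ν.real (Set.Iic p.1) / 2))) *
            ENNReal.ofReal (Real.exp (-(m * ν.real (Set.Iic p.2) / 2))))) ∂(ν.prod ν) := by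
          refine lintegral_mono fun p => ?_
          rw [ENNReal.ofReal_mul measureReal_nonneg, ofReal_measureReal, mul_left_comm,
            ← ENNReal.ofReal_mul (Real.exp_pos _).le, ← ENNReal.ofReal_mul (Real.exp_pos _).le]
          gcongr
          exact pairAvoid_pow_le ν p.1 p.2 hm
      _ = ENNReal.ofReal (Real.exp 1) * ∫⁻ x, (∫⁻ u, (Set.Ici x).indicator (fun u =>
            ENNReal.ofReal (Real.exp (-(m * ν.real (Set.Iic u) / 2)))) u ∂ν) ^ 2 ∂ν := by
          rw [lintegral_const_mul' _ _ ENNReal.ofReal_ne_top, lintegral_shared_eq ν hφ]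
      _ ≤ ENNReal.ofReal (Real.exp 1) * ∫⁻ x, upperMass d m x ^ 2 ∂(cube d) := by
          rw [← map_cdfMap μ, lintegral_map ((measurable_upperMass d m).pow_const 2)
            (measurable_cdfMap μ)]
          gcongr with x
          exact lintegral_Ici_exp_le_upperMass μ m x
      _ ≤ ENNReal.ofReal (Real.exp 1) *
          (ENNReal.ofReal (200 * 64 ^ d * (m : ℝ)⁻¹ ^ 2) * lowVolume d m) := by
          gcongr
          exact lintegral_upperMass_sq_le hm' hd
      _ = _ := by
          rw [← ENNReal.ofReal_toReal (lowVolume_ne_top d m), ← ENNReal.ofReal_mul (by positivity),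
            ← ENNReal.ofReal_mul (Real.exp_pos _).le,
            ENNReal.toReal_ofReal ENNReal.toReal_nonneg]
          congr 1
          field_simp
  rw [sharedCover, integral_eq_lintegral_of_nonneg_ae]
  · exact ENNReal.toReal_le_of_le_ofReal (by positivity) hbound
  · exact Filter.Eventually.of_forall fun p =>
      mul_nonneg measureReal_nonneg (pow_nonneg (pairAvoid_nonneg ν _ _) _)
  · exact ((measurable_measureReal_Iic_inf ν).mul
      ((measurable_pairAvoid ν).pow_const _)).aestronglyMeasurable

/-! ### Component independence and the bounds -/

section Structure

variable {Ω : Type*} [MeasurableSpace Ω] {n d : ℕ} {P : Measure Ω}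
  {ν : Measure (Fin d → ℝ)} {T : Ω → Fin n → Fin d → ℝ}

/-- Two independent copies of an attribute would coincide at an atom with positive probability. -/
lemma nullSingletonClass_attribute (hT : IsIIDRelation P T ν) (hC : ComponentIndependence P T)
    {i j : Fin n} (hij : i ≠ j) (a : Fin d) :
    NullSingletonClass (P.map fun ω => T ω i a) := by
  have hm : ∀ k, Measurable fun ω => T ω k a := fun k =>
    (measurable_pi_apply a).comp ((measurable_pi_apply k).comp hT.measurable)
  have hlaw : P.map (fun ω => T ω j a) = P.map (fun ω => T ω i a) := by
    have h : ∀ k, P.map (fun ω => T ω k a) = ν.map (fun y => y a) := fun k => by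
      have hk : Measurable fun ω => T ω k := (measurable_pi_apply k).comp hT.measurable
      rw [← hT.law k, Measure.map_map (measurable_pi_apply a) hk]
      rfl
    rw [h, h]
  refine ⟨fun x => ?_⟩
  have hind : IndepFun (fun ω => T ω i a) (fun ω => T ω j a) P :=
    (hT.indep.indepFun hij).comp (measurable_pi_apply a) (measurable_pi_apply a)
  have hprod := hind.measure_inter_preimage_eq_mul {x} {x} (measurableSet_singleton x)
    (measurableSet_singleton x)
  rw [← Measure.map_apply (hm i) (measurableSet_singleton x),
    ← Measure.map_apply (hm j) (measurableSet_singleton x), hlaw] at hprod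
  have hzero : P ((fun ω => T ω i a) ⁻¹' {x} ∩ (fun ω => T ω j a) ⁻¹' {x}) = 0 := by
    refine measure_mono_null (fun ω hω => ?_) (hC.distinct_values i j hij a)
    exact not_not.2 (hω.1.trans hω.2.symm)
  rw [hzero] at hprod
  exact mul_self_eq_zero.1 hprod.symm

variable [IsProbabilityMeasure P]

/-- Under component independence the tuples have a product distribution without atoms. -/
lemma exists_eq_pi (hT : IsIIDRelation P T ν) (hC : ComponentIndependence P T) (hn : 1 < n) :
    ∃ μ : Fin d → Measure ℝ, (∀ a, IsProbabilityMeasure (μ a)) ∧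
      (∀ a, NullSingletonClass (μ a)) ∧ ν = Measure.pi μ := by
  have hm : ∀ a, Measurable fun ω => T ω ⟨0, zero_lt_one.trans hn⟩ a := fun a =>
    (measurable_pi_apply a).comp ((measurable_pi_apply _).comp hT.measurable)
  refine ⟨fun a => P.map fun ω => T ω ⟨0, zero_lt_one.trans hn⟩ a,
    fun a => Measure.isProbabilityMeasure_map (hm a).aemeasurable,
    fun a => nullSingletonClass_attribute hT hC (j := ⟨1, hn⟩) (by simp) a, ?_⟩
  rw [← hT.law ⟨0, zero_lt_one.trans hn⟩]
  exact (iIndepFun_iff_map_fun_eq_pi_map fun a => (hm a).aemeasurable).1 (hC.attribute_indep _)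

end Structure

lemma expectedSkylineSize_nonneg {d : ℕ} (ν : Measure (Fin d → ℝ)) (m : ℕ) :
    0 ≤ expectedSkylineSize ν m :=
  integral_nonneg fun _ => Nat.cast_nonneg _

/-- The constant in the bound for the variance of the error. -/
noncomputable def varianceConst (d : ℕ) : ℝ := 1 + Real.exp 1 * (200 * 64 ^ d) * Real.exp 2

lemma one_le_varianceConst (d : ℕ) : 1 ≤ varianceConst d :=
  le_add_of_nonneg_right (by positivity)

section Product

variable {d : ℕ} (μ : Fin d → Measure ℝ) [∀ a, IsProbabilityMeasure (μ a)]

lemma integrable_one_sub_measureReal_Iic_pow (ν : Measure (Fin d → ℝ)) [IsProbabilityMeasure ν]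
    (k : ℕ) : Integrable (fun u => (1 - ν.real (Set.Iic u)) ^ k) ν := by
  refine Integrable.of_bound (C := 1)
    (((measurable_measureReal_Iic ν).const_sub 1).pow_const k).aestronglyMeasurable
    (Filter.Eventually.of_forall fun u => ?_)
  have h : 0 ≤ 1 - ν.real (Set.Iic u) := sub_nonneg.2 measureReal_le_one
  rw [Real.norm_of_nonneg (pow_nonneg h k)]
  exact pow_le_one₀ h (sub_le_self _ measureReal_nonneg)

lemma uncoveredProb_le_pred (ν : Measure (Fin d → ℝ)) [IsProbabilityMeasure ν] (m : ℕ) :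
    uncoveredProb ν m ≤ uncoveredProb ν (m - 1) :=
  integral_mono (integrable_one_sub_measureReal_Iic_pow ν m)
    (integrable_one_sub_measureReal_Iic_pow ν (m - 1)) fun _ =>
      pow_le_pow_of_le_one (sub_nonneg.2 measureReal_le_one) (sub_le_self _ measureReal_nonneg)
        (Nat.sub_le m 1)

lemma mul_mul_one_sub_pow_le_one {x : ℝ} (h0 : 0 ≤ x) (h1 : x ≤ 1) {m : ℕ} (hm : 1 ≤ m) :
    m * (x * (1 - x) ^ (m - 1)) ≤ 1 := by
  -- The left-hand side is the probability of exactly one success in `m` Bernoulli trials.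
  have hsum := add_pow x (1 - x) m
  rw [add_sub_cancel, one_pow] at hsum
  refine le_of_le_of_eq (le_of_eq_of_le ?_ (Finset.single_le_sum
    (f := fun k => x ^ k * (1 - x) ^ (m - k) * (m.choose k : ℝ)) (fun k _ => ?_)
    (Finset.mem_range.2 (Nat.lt_succ_of_le hm)))) hsum.symm
  · simp only [pow_one, Nat.choose_one_right]
    ring
  · have := sub_nonneg.2 h1
    positivity

lemma uncoveredProb_pred_le (ν : Measure (Fin d → ℝ)) [IsProbabilityMeasure ν] {m : ℕ}
    (hm : 1 ≤ m) : uncoveredProb ν (m - 1) ≤ uncoveredProb ν m + 1 / m := by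
  have hm0 : (0 : ℝ) < m := by exact_mod_cast hm
  have hint := integrable_one_sub_measureReal_Iic_pow ν m
  have hadd : uncoveredProb ν m + 1 / m = ∫ u, ((1 - ν.real (Set.Iic u)) ^ m + 1 / m) ∂ν := by
    rw [integral_add hint (integrable_const _)]
    simp [uncoveredProb]
  rw [hadd]
  refine integral_mono (integrable_one_sub_measureReal_Iic_pow ν (m - 1))
    (hint.add (integrable_const _)) fun u => ?_
  have h := mul_mul_one_sub_pow_le_one (measureReal_nonneg (μ := ν) (s := Set.Iic u))
    measureReal_le_one hm
  obtain ⟨k, rfl⟩ := Nat.exists_eq_add_of_le' hm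
  rw [← le_div_iff₀' hm0] at h
  simp only [Nat.add_sub_cancel] at h ⊢
  linarith [pow_succ (1 - ν.real (Set.Iic u)) k]

variable [∀ a, NullSingletonClass (μ a)]

lemma lowVolume_le_uncoveredProb {k m : ℕ} (hm : 2 ≤ m) (hk : k ≤ m) :
    Real.exp (-2) * (lowVolume d m).toReal ≤ uncoveredProb (Measure.pi μ) k := by
  rw [uncoveredProb_pi]
  exact lowVolume_le_integral hm hk

lemma lowVolume_le_uncoveredProb_pred {m : ℕ} (hm : 1 ≤ m) :
    (lowVolume d m).toReal ≤ Real.exp 2 * uncoveredProb (Measure.pi μ) (m - 1) := by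
  rcases hm.eq_or_lt with rfl | h
  · have h1 : uncoveredProb (Measure.pi μ) (1 - 1) = 1 := by simp [uncoveredProb]
    rw [h1, mul_one]
    exact (measureReal_le_one (μ := cube d)).trans (Real.one_le_exp zero_le_two)
  · have h2 := mul_le_mul_of_nonneg_left (lowVolume_le_uncoveredProb μ h (Nat.sub_le m 1))
      (Real.exp_pos 2).le
    rwa [← mul_assoc, ← Real.exp_add, add_neg_cancel, Real.exp_zero, one_mul] at h2

end Product

section Bounds

variable {Ω : Type*} [MeasurableSpace Ω] {n d m : ℕ} {P : Measure Ω} [IsProbabilityMeasure P]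
  {ν : Measure (Fin d → ℝ)} {T : Ω → Fin n → Fin d → ℝ} {S : Ω → Finset (Fin n)}

lemma expectedSkylineSize_pi (hd : 1 ≤ d) (μ : Fin d → Measure ℝ)
    [∀ a, IsProbabilityMeasure (μ a)] [∀ a, NullSingletonClass (μ a)] (m : ℕ) :
    expectedSkylineSize (Measure.pi μ) m = m * uncoveredProb (Measure.pi μ) (m - 1) :=
  have : NullSingletonClass (Measure.pi μ) := Measure.pi_nullSingletonClass ⟨0, hd⟩
  expectedSkylineSize_eq _ m

lemma errorVariance_le_of_lt (hd : 1 ≤ d) (hm : 1 ≤ m) (hmn : m < n) (hT : IsIIDRelation P T ν)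
    (hC : ComponentIndependence P T) (hS : IsSampleWithoutReplacement P T m S) :
    errorVariance P T S ≤ varianceConst d * (expectedSkylineSize ν m / (m : ℝ) ^ 2) := by
  obtain ⟨μ, hμ, hμ0, rfl⟩ := exists_eq_pi hT hC (hm.trans_lt hmn)
  have hm0 : (0 : ℝ) < m := by exact_mod_cast hm
  have hmn' : (m : ℝ) ≤ n := by exact_mod_cast hmn.le
  have hn0 : (0 : ℝ) < n := hm0.trans_le hmn'
  have hq := uncoveredProb_nonneg (Measure.pi μ) (m - 1)
  have hV := lowVolume_le_uncoveredProb_pred μ hm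
  have hcover : (m : ℝ) * sharedCover (Measure.pi μ) (m - 1)
      ≤ Real.exp 1 * (200 * 64 ^ d) * Real.exp 2 * (uncoveredProb (Measure.pi μ) (m - 1) / m) := by
    calc (m : ℝ) * sharedCover (Measure.pi μ) (m - 1)
        ≤ m * (Real.exp 1 * (200 * 64 ^ d) * ((lowVolume d m).toReal / m ^ 2)) := by
          gcongr
          exact sharedCover_pi_le hd μ hm
      _ ≤ m * (Real.exp 1 * (200 * 64 ^ d) *
          ((Real.exp 2 * uncoveredProb (Measure.pi μ) (m - 1)) / m ^ 2)) := by gcongr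
      _ = _ := by field_simp
  have hcover0 : 0 ≤ (m : ℝ) * sharedCover (Measure.pi μ) (m - 1) :=
    mul_nonneg hm0.le (integral_nonneg fun p => mul_nonneg measureReal_nonneg
      (pow_nonneg (pairAvoid_nonneg _ p.1 p.2) _))
  have hfrac : (((n - m : ℕ) : ℝ) / n) ^ 2 ≤ 1 := by
    refine pow_le_one₀ (by positivity) (div_le_one_of_le₀ ?_ hn0.le)
    exact_mod_cast Nat.sub_le n m
  calc errorVariance P T S
      ≤ uncoveredProb (Measure.pi μ) m / n + (((n - m : ℕ) : ℝ) / n) ^ 2 *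
        (pairUncoveredProb (Measure.pi μ) m - uncoveredProb (Measure.pi μ) m ^ 2) :=
        errorVariance_le hT hS (hm.trans hmn.le)
    _ ≤ uncoveredProb (Measure.pi μ) (m - 1) / m + (((n - m : ℕ) : ℝ) / n) ^ 2 *
        (m * sharedCover (Measure.pi μ) (m - 1)) := by
        gcongr
        · exact uncoveredProb_le_pred _ m
        · exact pairUncoveredProb_sub_sq_le _ (measureReal_pi_Iic_mul_le μ) m
    _ ≤ uncoveredProb (Measure.pi μ) (m - 1) / m + m * sharedCover (Measure.pi μ) (m - 1) := by
        exact add_le_add le_rfl (mul_le_of_le_one_left hcover0 hfrac)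
    _ ≤ varianceConst d * (uncoveredProb (Measure.pi μ) (m - 1) / m) := by
        rw [varianceConst, add_mul, one_mul]
        gcongr
    _ = varianceConst d * (expectedSkylineSize (Measure.pi μ) m / (m : ℝ) ^ 2) := by
        rw [expectedSkylineSize_pi hd]
        field_simp

lemma errorVariance_le_const_mul (hd : 1 ≤ d) (hm : 1 ≤ m) (hmn : m ≤ n)
    (hT : IsIIDRelation P T ν) (hC : ComponentIndependence P T)
    (hS : IsSampleWithoutReplacement P T m S) :
    errorVariance P T S ≤ varianceConst d * (expectedSkylineSize ν m / (m : ℝ) ^ 2) := by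
  rcases hmn.eq_or_lt with rfl | h
  · rw [errorVariance_self hS]
    exact mul_nonneg (zero_le_one.trans (one_le_varianceConst d))
      (div_nonneg (expectedSkylineSize_nonneg ν m) (sq_nonneg _))
  · exact errorVariance_le_of_lt hd hm h hT hC hS

lemma sqrt_errorVariance_le (hd : 1 ≤ d) (hm : 1 ≤ m) (hmn : m ≤ n)
    (hT : IsIIDRelation P T ν) (hC : ComponentIndependence P T)
    (hS : IsSampleWithoutReplacement P T m S) :
    Real.sqrt (errorVariance P T S)
      ≤ varianceConst d * (Real.sqrt (expectedSkylineSize ν m) / (m : ℝ)) := by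
  have hK := one_le_varianceConst d
  have hs := expectedSkylineSize_nonneg ν m
  refine Real.sqrt_le_iff.2 ⟨by positivity, ?_⟩
  refine (errorVariance_le_const_mul hd hm hmn hT hC hS).trans ?_
  rw [mul_pow, div_pow, Real.sq_sqrt hs]
  gcongr
  exact le_self_pow₀ hK two_ne_zero

/-- For at least two attributes `m * uncoveredProb ν m` is at least a constant times `log m`. It
thus exceeds the constants `1` and `2 / (η * (1 - c)) ^ 2` once `m` is large, which is all that the
comparison with the expected error requires. -/
lemma sqrt_expectedSkylineSize_le (hd : 2 ≤ d) {c η : ℝ} (hc : c < 1) (hη : 0 < η) (hm : 2 ≤ m)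
    (hlog1 : Real.exp 2 ≤ Real.log m) (hlog2 : Real.exp 2 * (2 / (η * (1 - c)) ^ 2) ≤ Real.log m)
    (hmn : (m : ℝ) ≤ c * n) (hT : IsIIDRelation P T ν) (hC : ComponentIndependence P T)
    (hS : IsSampleWithoutReplacement P T m S) :
    Real.sqrt (expectedSkylineSize ν m) / (m : ℝ) ≤ η * expectedError P T S := by
  have hm1 : 1 ≤ m := one_le_two.trans hm
  have hm0 : (0 : ℝ) < m := by exact_mod_cast hm1
  have hc' : 0 < 1 - c := sub_pos.2 hc
  have hn0 : (0 : ℝ) < n := by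
    rcases n.cast_nonneg (α := ℝ) |>.eq_or_lt with h | h
    · rw [← h, mul_zero] at hmn
      linarith
    · exact h
  have hlt : m < n := by
    have : (m : ℝ) < n := hmn.trans_lt (mul_lt_of_lt_one_left hn0 hc)
    exact_mod_cast this
  obtain ⟨μ, hμ, hμ0, rfl⟩ := exists_eq_pi hT hC (hm1.trans_lt hlt)
  rw [expectedError_eq hT hS, expectedSkylineSize_pi (one_le_two.trans hd)]
  set q := uncoveredProb (Measure.pi μ) m with hq
  have hpred := uncoveredProb_pred_le (Measure.pi μ) hm1
  rw [← hq] at hpred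
  have hlow : Real.log m ≤ Real.exp 2 * (m * q) := by
    have hV : Real.log m / m ≤ (lowVolume d m).toReal := by
      have h := log_div_le_lowVolume (t := m) (by exact_mod_cast hm1) hd
      exact (ENNReal.ofReal_le_iff_le_toReal (lowVolume_ne_top d m)).1 h
    have h := lowVolume_le_uncoveredProb μ hm le_rfl
    rw [Real.exp_neg, inv_mul_le_iff₀ (Real.exp_pos 2)] at h
    rw [div_le_iff₀ hm0] at hV
    nlinarith
  have hL1 : 1 ≤ m * q := by
    have := hlog1.trans hlow
    rwa [le_mul_iff_one_le_right (Real.exp_pos 2)] at this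
  have hL2 : 2 / (η * (1 - c)) ^ 2 ≤ m * q :=
    le_of_mul_le_mul_left (hlog2.trans hlow) (Real.exp_pos 2)
  have hq0 : 0 ≤ q := uncoveredProb_nonneg _ m
  have hfrac : 1 - c ≤ ((n - m : ℕ) : ℝ) / n := by
    rw [le_div_iff₀ hn0, Nat.cast_sub hlt.le]
    linarith
  have hmain : Real.sqrt (m * uncoveredProb (Measure.pi μ) (m - 1)) ≤ m * (η * ((1 - c) * q)) := by
    refine Real.sqrt_le_iff.2 ⟨by positivity, ?_⟩
    have h1 : m * uncoveredProb (Measure.pi μ) (m - 1) ≤ 2 * (m * q) := by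
      have := mul_le_mul_of_nonneg_left hpred hm0.le
      rw [mul_add, mul_one_div_cancel hm0.ne'] at this
      linarith
    have h2 : 2 ≤ m * q * (η * (1 - c)) ^ 2 := by
      rwa [div_le_iff₀ (by positivity)] at hL2
    calc m * uncoveredProb (Measure.pi μ) (m - 1) ≤ 2 * (m * q) := h1
      _ ≤ m * q * (η * (1 - c)) ^ 2 * (m * q) := by gcongr
      _ = (m * (η * ((1 - c) * q))) ^ 2 := by ring
  rw [div_le_iff₀' hm0]
  refine hmain.trans ?_
  gcongr

end Bounds

end SkylineSampling

theorem mainTheorem5 (d : ℕ) (hd : 1 ≤ d) :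
    (∃ C : ℝ, 0 < C ∧
      ∀ (n m : ℕ), 1 ≤ m → m ≤ n →
      ∀ {Ω : Type*} [MeasurableSpace Ω] (P : Measure Ω) [IsProbabilityMeasure P]
        (ν : Measure (Fin d → ℝ)) (T : Ω → Fin n → Fin d → ℝ) (S : Ω → Finset (Fin n)),
        SkylineSampling.IsIIDRelation P T ν →
        SkylineSampling.ComponentIndependence P T →
        SkylineSampling.IsSampleWithoutReplacement P T m S →
        SkylineSampling.errorVariance P T S
            ≤ C * (SkylineSampling.expectedSkylineSize ν m / (m : ℝ) ^ 2) ∧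
        Real.sqrt (SkylineSampling.errorVariance P T S)
            ≤ C * (Real.sqrt (SkylineSampling.expectedSkylineSize ν m) / (m : ℝ))) ∧
    (2 ≤ d → ∀ c : ℝ, 0 < c → c < 1 → ∀ δ : ℝ, 0 < δ → ∃ M : ℕ,
      ∀ (n m : ℕ), 1 ≤ m → M ≤ m → (m : ℝ) ≤ c * (n : ℝ) →
      ∀ {Ω : Type*} [MeasurableSpace Ω] (P : Measure Ω) [IsProbabilityMeasure P]
        (ν : Measure (Fin d → ℝ)) (T : Ω → Fin n → Fin d → ℝ) (S : Ω → Finset (Fin n)),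
        SkylineSampling.IsIIDRelation P T ν →
        SkylineSampling.ComponentIndependence P T →
        SkylineSampling.IsSampleWithoutReplacement P T m S →
        Real.sqrt (SkylineSampling.expectedSkylineSize ν m) / (m : ℝ)
            ≤ δ * SkylineSampling.expectedError P T S ∧
        Real.sqrt (SkylineSampling.errorVariance P T S)
            ≤ δ * SkylineSampling.expectedError P T S) := by
  have hK := SkylineSampling.one_le_varianceConst d
  have hK0 : 0 < SkylineSampling.varianceConst d := zero_lt_one.trans_le hK
  refine ⟨⟨SkylineSampling.varianceConst d, hK0, ?_⟩, ?_⟩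
  · intro n m hm hmn Ω _ P _ ν T S hT hC hS
    exact ⟨SkylineSampling.errorVariance_le_const_mul hd hm hmn hT hC hS,
      SkylineSampling.sqrt_errorVariance_le hd hm hmn hT hC hS⟩
  · intro hd2 c _ hc1 δ hδ
    -- Dividing `δ` by the constant of the variance bound makes one estimate serve both claims.
    set η := δ / SkylineSampling.varianceConst d with hη
    have hη0 : 0 < η := div_pos hδ hK0
    have hlog := Real.tendsto_log_atTop.comp (tendsto_natCast_atTop_atTop (R := ℝ))
    obtain ⟨M, hM⟩ := Filter.eventually_atTop.1 ((Filter.eventually_ge_atTop 2).and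
      ((hlog.eventually_ge_atTop (Real.exp 2)).and
        (hlog.eventually_ge_atTop (Real.exp 2 * (2 / (η * (1 - c)) ^ 2)))))
    refine ⟨M, fun n m hm hMm hmn Ω _ P _ ν T S hT hC hS => ?_⟩
    obtain ⟨h2, h3, h4⟩ := hM m hMm
    have hmain := SkylineSampling.sqrt_expectedSkylineSize_le hd2 hc1 hη0 h2 h3 h4 hmn hT hC hS
    have hnonneg : 0 ≤ SkylineSampling.expectedError P T S :=
      integral_nonneg fun ω => SkylineSampling.baselineError_nonneg _ _
    have hle : m ≤ n := by
      have h : (m : ℝ) ≤ n := hmn.trans (mul_le_of_le_one_left n.cast_nonneg hc1.le)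
      exact_mod_cast h
    refine ⟨hmain.trans ?_, ?_⟩
    · exact mul_le_mul_of_nonneg_right (div_le_self hδ.le hK) hnonneg
    · refine (SkylineSampling.sqrt_errorVariance_le hd hm hle hT hC hS).trans ?_
      refine (mul_le_mul_of_nonneg_left hmain hK0.le).trans_eq ?_
      rw [hη, ← mul_assoc, mul_div_cancel₀ _ hK0.ne']
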